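/- **Conventions.** Let $(X,d)$ be a geodesic metric space and write $|x-y|=d(x,y)$. A symbol $[a,b]$ denotes a geodesic segment from $a$ to $b$ (not necessarily unique); for $x\in X$, $\pi_{ab}(x)$ is the set of points of $[a,b]$ minimizing the distance to $x$. The Hausdorff $r$-neighborhood of a set consists of the points at distance at most $r$ from some point of it, and two sets are $r$-Hausdorff equivalent if each is contained in the Hausdorff $r$-neighborhood of the other. For a constant $C>0$ consider the axioms: - **(DD)** for every geodesic segment $[a,b]$, all $x,x'\in X$, $p\in\pi_{ab}(x)$ and $p'\in\pi_{ab}(x')$, one has $|p-p'|<|x-x'|+C$; - **(FT)** for all geodesic segments $[a,b]$, $[a',b']$ with $|a-a'|\le D$ and $|b-b'|\le D$, the segment $[a',b']$ is contained in the Hausdorff $(C+D)$-neighborhood of $[a,b]$. A geodesic segment is $B$-contracting if for every metric ball disjoint from it the projection of the ball to it has diameter $<B$. Let a group $\Gamma$ act on $X$ by isometries and fix a basepoint $x_0\in X$. - An element $g\in\Gamma$ is *rank 1* if $|g^n(x_0)-x_0|\to\infty$ as $n\to\infty$ and there is $B>0$ such that for every $n>0$ some geodesic $[x_0,g^n(x_0)]$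 is $B$-Hausdorff equivalent to $\{x_0,g(x_0),\dots,g^n(x_0)\}$ and some geodesic $[x_0,g^n(x_0)]$ is $B$-contracting. - Rank 1 elements $g,h$ are *independent* if the function $\mathbb Z^2\to[0,\infty)$, $(m,n)\mapsto|g^m(x_0)-h^n(x_0)|$, is proper. - For rank 1 elements $g,h$ write $g\sim h$ if there are $K>0$, sequences of positive integers $m_i,n_i\to\infty$ and elements $\gamma_i\in\Gamma$ such that $[x_0,g^{m_i}(x_0)]$ and $\gamma_i[x_0,h^{n_i}(x_0)]$ are $K$-Hausdorff equivalent as oriented segments, i.e. they are $K$-Hausdorff equivalent and moreover $|x_0-\gamma_i(x_0)|\le K$ and $|g^{m_i}(x_0)-\gamma_ih^{n_i}(x_0)|\le K$. A function $\phi:\Gamma\to\mathbb R$ is a quasi-homomorphism if $\sup_{x,y\in\Gamma}|\phi(xy)-\phi(x)-\phi(y)|<\infty$, and $$\widetilde{QH}(\Gamma)=\{\text{quasi-homomorphisms }\phi:\Gamma\to\mathbb R\}\big/\big(\mathrm{Hom}(\Gamma,\mathbb R)+\{\text{bounded }\phi:\Gamma\to\mathbb R\}\big).$$ **Theorem.**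 Let $\Gamma$ be a group acting by isometries on a geodesic metric space $X$ that satisfies (DD) and (FT) for some constant $C>0$. Suppose there exist independent rank 1 elements $g_1,g_2\in\Gamma$ such that $g_1\not\sim g_2$. Then the real vector space $\widetilde{QH}(\Gamma)$ is infinite-dimensional. -/

import Mathlib

/-! ### Quasi-homomorphisms and the space `QH~(Γ)` -/

/-- The real vector space of quasi-homomorphisms `φ : Γ → ℝ`, that is, of functions with
`sup_{x,y} |φ(xy) - φ(x) - φ(y)| < ∞`. -/
def quasiHomomorphisms (Γ : Type*) [Group Γ] : Submodule ℝ (Γ → ℝ) where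
  carrier := {φ | ∃ R : ℝ, ∀ x y : Γ, |φ (x * y) - φ x - φ y| ≤ R}
  zero_mem' := ⟨0, fun x y => by simp⟩
  add_mem' := by
    rintro φ ψ ⟨R, hR⟩ ⟨S, hS⟩
    refine ⟨R + S, fun x y => ?_⟩
    have h : (φ + ψ) (x * y) - (φ + ψ) x - (φ + ψ) y
        = (φ (x * y) - φ x - φ y) + (ψ (x * y) - ψ x - ψ y) := by
      simp only [Pi.add_apply]; ring
    rw [h]
    exact (abs_add_le _ _).trans (add_le_add (hR x y) (hS x y))
  smul_mem' := by
    rintro c φ ⟨R, hR⟩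
    refine ⟨|c| * R, fun x y => ?_⟩
    have h : (c • φ) (x * y) - (c • φ) x - (c • φ) y = c * (φ (x * y) - φ x - φ y) := by
      simp only [Pi.smul_apply, smul_eq_mul]; ring
    rw [h, abs_mul]
    exact mul_le_mul_of_nonneg_left (hR x y) (abs_nonneg c)

/-- The real vector space `Hom(Γ, ℝ)` of homomorphisms from `Γ` to the additive group `ℝ`. -/
def realHomomorphisms (Γ : Type*) [Group Γ] : Submodule ℝ (Γ → ℝ) where
  carrier := {φ | ∀ x y : Γ, φ (x * y) = φ x + φ y}
  zero_mem' := fun x y => by simp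
  add_mem' := by
    intro φ ψ hφ hψ x y
    simp only [Pi.add_apply, hφ x y, hψ x y]; ring
  smul_mem' := by
    intro c φ hφ x y
    simp only [Pi.smul_apply, smul_eq_mul, hφ x y]; ring

/-- The real vector space of bounded functions `Γ → ℝ`. -/
def boundedFunctions (Γ : Type*) [Group Γ] : Submodule ℝ (Γ → ℝ) where
  carrier := {φ | ∃ R : ℝ, ∀ x : Γ, |φ x| ≤ R}
  zero_mem' := ⟨0, fun x => by simp⟩
  add_mem' := by
    rintro φ ψ ⟨R, hR⟩ ⟨S, hS⟩
    exact ⟨R + S, fun x => (abs_add_le _ _).trans (add_le_add (hR x) (hS x))⟩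
  smul_mem' := by
    rintro c φ ⟨R, hR⟩
    refine ⟨|c| * R, fun x => ?_⟩
    rw [Pi.smul_apply, smul_eq_mul, abs_mul]
    exact mul_le_mul_of_nonneg_left (hR x) (abs_nonneg c)

/-- `QH~(Γ)`: quasi-homomorphisms modulo the sum of the homomorphisms and the bounded functions.
(Both of these consist of quasi-homomorphisms.) -/
abbrev QHTilde (Γ : Type*) [Group Γ] : Type _ :=
  quasiHomomorphisms Γ ⧸
    (realHomomorphisms Γ ⊔ boundedFunctions Γ).submoduleOf (quasiHomomorphisms Γ)

/-! ### Geodesics, projections and the two axioms -/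

/-- `σ` is (the image of) a geodesic segment from `a` to `b`. -/
def IsGeodesicSegment {X : Type*} [MetricSpace X] (σ : Set X) (a b : X) : Prop :=
  ∃ c : ℝ → X, c 0 = a ∧ c (dist a b) = b ∧
    (∀ s ∈ Set.Icc 0 (dist a b), ∀ t ∈ Set.Icc 0 (dist a b), dist (c s) (c t) = |s - t|) ∧
    σ = c '' Set.Icc 0 (dist a b)

/-- `X` is a geodesic metric space: any two points are joined by at least one geodesic. -/
def IsGeodesicMetricSpace (X : Type*) [MetricSpace X] : Prop :=
  ∀ a b : X, ∃ σ : Set X, IsGeodesicSegment σ a b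

/-- The multivalued nearest point projection: the set of the points of `σ` that minimize the
distance to `x`. -/
def nearestPoints {X : Type*} [MetricSpace X] (σ : Set X) (x : X) : Set X :=
  {p | p ∈ σ ∧ ∀ q ∈ σ, dist x p ≤ dist x q}

/-- The Hausdorff `r`-neighbourhood of a set. -/
def hausdorffNeighborhood {X : Type*} [MetricSpace X] (r : ℝ) (S : Set X) : Set X :=
  {p | ∃ q ∈ S, dist p q ≤ r}

/-- Two sets are `r`-Hausdorff equivalent if each lies in the Hausdorff `r`-neighbourhood of the
other. -/
def HausdorffEquivalent {X : Type*} [MetricSpace X] (r : ℝ) (S T : Set X) : Prop :=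
  S ⊆ hausdorffNeighborhood r T ∧ T ⊆ hausdorffNeighborhood r S

/-- Axiom (DD) with constant `C`: projections to geodesic segments coarsely decrease distances. -/
def AxiomDD (X : Type*) [MetricSpace X] (C : ℝ) : Prop :=
  ∀ (a b : X) (σ : Set X), IsGeodesicSegment σ a b →
    ∀ (x x' : X), ∀ p ∈ nearestPoints σ x, ∀ p' ∈ nearestPoints σ x',
      dist p p' < dist x x' + C

/-- Axiom (FT) with constant `C`: the strong fellow traveller property. -/
def AxiomFT (X : Type*) [MetricSpace X] (C : ℝ) : Prop :=
  ∀ (D : ℝ) (a b a' b' : X) (σ σ' : Set X), dist a a' ≤ D → dist b b' ≤ D →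
    IsGeodesicSegment σ a b → IsGeodesicSegment σ' a' b' →
      σ' ⊆ hausdorffNeighborhood (C + D) σ

/-- `σ` is `B`-contracting: the projection to `σ` of every metric ball disjoint from `σ` has
diameter less than `B`. (For a geodesic segment `σ` such a projection is a bounded set.) -/
def IsContracting {X : Type*} [MetricSpace X] (B : ℝ) (σ : Set X) : Prop :=
  ∀ (z : X) (r : ℝ), Disjoint (Metric.ball z r) σ →
    Metric.diam (⋃ x ∈ Metric.ball z r, nearestPoints σ x) < B

/-! ### Rank 1 elements of a group acting on `X` -/

/-- `g` acts as a rank 1 isometry (with respect to the basepoint `x₀`). -/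
def IsRankOne {Γ X : Type*} [Group Γ] [MetricSpace X] [MulAction Γ X] (x₀ : X) (g : Γ) : Prop :=
  Filter.Tendsto (fun n : ℕ => dist (g ^ n • x₀) x₀) Filter.atTop Filter.atTop ∧
  ∃ B : ℝ, 0 < B ∧ ∀ n : ℕ, 0 < n →
    (∃ σ : Set X, IsGeodesicSegment σ x₀ (g ^ n • x₀) ∧
      HausdorffEquivalent B σ {y | ∃ k : ℕ, k ≤ n ∧ y = g ^ k • x₀}) ∧
    (∃ σ : Set X, IsGeodesicSegment σ x₀ (g ^ n • x₀) ∧ IsContracting B σ)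

/-- Independence of two (rank 1) elements: the function `(m, n) ↦ |g ^ m x₀ - h ^ n x₀|` on the
discrete space `ℤ × ℤ` is proper. -/
def AreIndependent {Γ X : Type*} [Group Γ] [MetricSpace X] [MulAction Γ X]
    (x₀ : X) (g h : Γ) : Prop :=
  Filter.Tendsto (fun mn : ℤ × ℤ => dist (g ^ mn.1 • x₀) (h ^ mn.2 • x₀))
    Filter.cofinite Filter.atTop

/-- The relation `g ∼ h`: for some `K > 0` there are `m_i, n_i → ∞` and `γ_i ∈ Γ` such that the
oriented segments `[x₀, g ^ m_i x₀]` and `γ_i [x₀, h ^ n_i x₀]` are `K`-Hausdorff equivalent, with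
initial points and terminal points corresponding to each other.

The relation has to see the orientation: as unoriented sets, `[x₀, g ^ m x₀]` and
`g ^ m [x₀, g ^ (-m) x₀]` are always Hausdorff equivalent, whereas the relation is used to
distinguish elements from their inverses. -/
def AreEquivalent {Γ X : Type*} [Group Γ] [MetricSpace X] [MulAction Γ X]
    (x₀ : X) (g h : Γ) : Prop :=
  ∃ K : ℝ, 0 < K ∧ ∃ (m n : ℕ → ℕ) (γ : ℕ → Γ),
    Filter.Tendsto m Filter.atTop Filter.atTop ∧ Filter.Tendsto n Filter.atTop Filter.atTop ∧
    ∀ i : ℕ,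
      dist x₀ (γ i • x₀) ≤ K ∧ dist (g ^ m i • x₀) (γ i • h ^ n i • x₀) ≤ K ∧
      ∃ σ τ : Set X, IsGeodesicSegment σ x₀ (g ^ m i • x₀) ∧
        IsGeodesicSegment τ x₀ (h ^ n i • x₀) ∧
        HausdorffEquivalent K σ ((fun x => γ i • x) '' τ)

/-!
The orbits of the basepoint under the powers of `g₁` and `g₂` are contracting lines: a path between
two points whose projections to such a line are far apart coarsely runs along the line
(`IsContractingLine`). As in a hyperbolic space, a concatenation of long segments of contracting
lines is coarsely geodesic as soon as consecutive segments are aligned, with an error that does not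
accumulate (`MarkedSegment.IsLong.precedes_of_aligned`).

Quasi-homomorphisms are obtained as a variant of Brooks counting. For a corner `w = g₁ ^ p * g₂ ^ q`
with long sides, `discountedDist` is the infimum `D x y` of the lengths of chains from `x` to `y`
that may traverse translates of the pair `x₀`, `w x₀`, from source to target only, at a discount
`θ`. In a nearly optimal chain all translates used are aligned, since a detour would cost more than
the discount; as the sides are long compared to `θ`, the local-to-global principle shows that they
are aligned with `x` and `y` as well. Consequently, a point of a contracting line that separates
`x` from `y` is coarsely between them for `D` too (`IsDiscountSystem.discounted_between`). This
allows one to replace the points of a triple, without changing the coboundary of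
`D x y - D y x` much, by points between which hardly any discount is available
(`IsDiscountSystem.exists_isReduction`). Therefore this antisymmetrization is a quasi-cocycle, and
`g ↦ D x₀ (g x₀) - D (g x₀) x₀` is a quasi-homomorphism (`cornerCount`).

Consider the powers of the blocks `g₁ ^ a * g₂ ^ b * g₁ ^ s * g₂ ^ s`. The orbit of the basepoint
along them is a broken geodesic with long pieces. Since `g₁` and `g₂` are not equivalent, no axis
fellow travels, in the same direction, long parts of both of them, so a translate of a side of the
corner that is aligned with the path must fellow travel one single piece
(`IsBrokenPath.exists_overlapping_segment`). There are two consequences.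
* If the side `g₁ ^ p` of the corner is much longer than all pieces of the path, no translate of
  the corner is aligned with the path, and `cornerCount` is bounded on the powers of the block
  (`IsTransversePair.abs_cornerCount_le`).
* If `a = p` and `b = q` with `q`, `p`, `s` of quite different sizes, each period contains a forward
  copy of the corner, but there is no backward one. Then `cornerCount` tends to `-∞` along the
  powers of the block (`IsTransversePair.discountedDist_pow_le`,
  `IsTransversePair.dist_sub_one_le_discountedDist`).

Let `V n` be the space of quasi-homomorphisms that are bounded on the powers of the blocks with
`g₁ ^ a`, `g₂ ^ b` of length at most `R + n`. By the two properties, the decreasing sequence `V n`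
never becomes stationary, and the same holds for the images in `QHTilde Γ`, as a homomorphism that
vanishes on the three blocks with `(a, b)` equal to `(s, s)`, `(s + 1, s)`, `(s, s + 1)` vanishes on
all of them. A finite-dimensional space has no such sequence of subspaces
(`not_finiteDimensional_QHTilde`).
-/

/-! ### Contracting lines -/

section ContractingLines

variable {X : Type*} [MetricSpace X]

/-- `ℓ a` is a nearest point to `x` among the points of the discrete line `ℓ`. -/
def IsNearest (ℓ : ℤ → X) (x : X) (a : ℤ) : Prop :=
  ∀ j, dist x (ℓ a) ≤ dist x (ℓ j)

/-- A discrete line `ℓ : ℤ → X` that is coarsely a geodesic and has the contraction property of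
a rank one axis, all with the same constant `B`. The contraction is stated for nearest points:
two points whose projections are more than `B` apart are coarsely joined by a geodesic that runs
along the line between the two projections. -/
structure IsContractingLine (B : ℝ) (ℓ : ℤ → X) : Prop where
  order : ∀ i j k, i ≤ j → j ≤ k →
    dist (ℓ i) (ℓ j) + dist (ℓ j) (ℓ k) ≤ dist (ℓ i) (ℓ k) + B
  exists_isNearest : ∀ x, ∃ a, IsNearest ℓ x a
  contracting : ∀ x y a b, IsNearest ℓ x a → IsNearest ℓ y b →
    dist (ℓ a) (ℓ b) ≤ B ∨
      dist x (ℓ a) + dist (ℓ a) (ℓ b) + dist (ℓ b) y ≤ dist x y + B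
  dist_succ_le : ∀ i, dist (ℓ i) (ℓ (i + 1)) ≤ B

/-- Points of `ℓ` whose indices differ by at least `N` are at distance at least `K`. -/
def IsSparse (K : ℝ) (N : ℤ) (ℓ : ℤ → X) : Prop :=
  ∀ i j, i + N ≤ j → K ≤ dist (ℓ i) (ℓ j)

lemma IsNearest.self (ℓ : ℤ → X) (j : ℤ) : IsNearest ℓ (ℓ j) j := fun k => by
  rw [dist_self]; exact dist_nonneg

lemma IsNearest.neg {ℓ : ℤ → X} {x : X} {a : ℤ} (h : IsNearest ℓ x a) :
    IsNearest (fun i => ℓ (-i)) x (-a) := fun j => by simpa using h (-j)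

lemma IsSparse.neg {K : ℝ} {N : ℤ} {ℓ : ℤ → X} (h : IsSparse K N ℓ) :
    IsSparse K N (fun i => ℓ (-i)) := fun i j hij => by
  rw [dist_comm]; exact h _ _ (by omega)

namespace IsContractingLine

variable {B : ℝ} {ℓ : ℤ → X}

lemma nonneg (h : IsContractingLine B ℓ) : 0 ≤ B :=
  dist_nonneg.trans (h.dist_succ_le 0)

lemma mono {B' : ℝ} (h : IsContractingLine B ℓ) (hB : B ≤ B') : IsContractingLine B' ℓ where
  order i j k hij hjk := (h.order i j k hij hjk).trans (by linarith)
  exists_isNearest := h.exists_isNearest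
  contracting x y a b ha hb := by
    rcases h.contracting x y a b ha hb with h1 | h1
    · exact Or.inl (h1.trans hB)
    · exact Or.inr (h1.trans (by linarith))
  dist_succ_le i := (h.dist_succ_le i).trans hB

lemma neg (h : IsContractingLine B ℓ) : IsContractingLine B (fun i => ℓ (-i)) where
  order i j k hij hjk := by
    have := h.order (-k) (-j) (-i) (by omega) (by omega)
    simp only [dist_comm (ℓ (-i)), dist_comm (ℓ (-j)) (ℓ (-k))]
    rw [dist_comm (ℓ (-j)) (ℓ (-i))] at *
    linarith [dist_comm (ℓ (-j)) (ℓ (-i))]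
  exists_isNearest x := by
    obtain ⟨a, ha⟩ := h.exists_isNearest x
    exact ⟨-a, ha.neg⟩
  contracting x y a b ha hb := by
    have ha' : IsNearest ℓ x (-a) := fun j => by simpa using ha (-j)
    have hb' : IsNearest ℓ y (-b) := fun j => by simpa using hb (-j)
    exact h.contracting x y _ _ ha' hb'
  dist_succ_le i := by
    have := h.dist_succ_le (-(i + 1))
    rw [dist_comm] at this
    simpa using this

/-- Going to a point of the line through the nearest point is coarsely optimal. -/
lemma dist_add_dist_nearest_le (h : IsContractingLine B ℓ) {x : X} {a : ℤ}
    (ha : IsNearest ℓ x a) (j : ℤ) :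
    dist x (ℓ a) + dist (ℓ a) (ℓ j) ≤ dist x (ℓ j) + B := by
  rcases h.contracting x (ℓ j) a j ha (IsNearest.self ℓ j) with h1 | h1
  · linarith [ha j]
  · simpa using h1

/-- The projection to the line is coarsely Lipschitz. -/
lemma dist_nearest_le (h : IsContractingLine B ℓ) {x y : X} {a b : ℤ}
    (ha : IsNearest ℓ x a) (hb : IsNearest ℓ y b) :
    dist (ℓ a) (ℓ b) ≤ dist x y + B := by
  rcases h.contracting x y a b ha hb with h1 | h1
  · linarith [dist_nonneg (x := x) (y := y)]
  · linarith [dist_nonneg (x := x) (y := ℓ a), dist_nonneg (x := ℓ b) (y := y)]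

/-- A point that is coarsely between two points of the line is near the line. -/
lemma dist_nearest_le_of_between (h : IsContractingLine B ℓ) {z : X} {a i j : ℤ} {c : ℝ}
    (ha : IsNearest ℓ z a) (hz : dist (ℓ i) z + dist z (ℓ j) ≤ dist (ℓ i) (ℓ j) + c) :
    2 * dist z (ℓ a) ≤ 2 * B + c := by
  have h1 := h.dist_add_dist_nearest_le ha i
  have h2 := h.dist_add_dist_nearest_le ha j
  have h3 := dist_triangle (ℓ i) (ℓ a) (ℓ j)
  rw [dist_comm (ℓ i) z] at hz
  rw [dist_comm (ℓ i) (ℓ a)] at h3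
  linarith

lemma dist_le_mul (h : IsContractingLine B ℓ) (i : ℤ) (n : ℕ) :
    dist (ℓ i) (ℓ (i + n)) ≤ n * B := by
  induction n with
  | zero => simp
  | succ n ih =>
    have h1 := dist_triangle (ℓ i) (ℓ (i + n)) (ℓ (i + n + 1))
    have h2 := h.dist_succ_le (i + n)
    push_cast
    rw [← add_assoc]
    linarith

lemma dist_le_mul_of_le (h : IsContractingLine B ℓ) {i j : ℤ} {M : ℕ} (hij : i ≤ j)
    (hj : j ≤ i + M) : dist (ℓ i) (ℓ j) ≤ M * B := by
  obtain ⟨n, rfl⟩ := Int.le.dest hij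
  refine (h.dist_le_mul i n).trans (mul_le_mul_of_nonneg_right ?_ h.nonneg)
  exact_mod_cast (by omega : n ≤ M)

/-- If `ℓ i` is coarsely between `x` and a later point `ℓ j`, then `x` projects before `ℓ i`, up
to a bounded number of indices. -/
lemma nearest_le (h : IsContractingLine B ℓ) {K : ℝ} {N : ℤ} (hs : IsSparse K N ℓ) {x : X}
    {a i j : ℤ} {c : ℝ} (ha : IsNearest ℓ x a) (hij : i + N ≤ j) (hN : 0 ≤ N)
    (hx : dist x (ℓ i) + dist (ℓ i) (ℓ j) ≤ dist x (ℓ j) + c) (hK : 2 * B + c < 2 * K) :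
    a ≤ i + N := by
  by_contra! hlt
  have h1 := h.dist_add_dist_nearest_le ha i
  have h2 := dist_triangle x (ℓ a) (ℓ j)
  have h3 := dist_comm (ℓ i) (ℓ a)
  rcases le_total a j with haj | haj
  · have h4 := h.order i a j (by omega) haj
    have h5 := hs i a hlt.le
    linarith
  · have h4 := h.order i j a (by omega) haj
    have h5 := hs i j hij
    have h6 := dist_comm (ℓ j) (ℓ a)
    linarith

lemma le_nearest (h : IsContractingLine B ℓ) {K : ℝ} {N : ℤ} (hs : IsSparse K N ℓ) {x : X}
    {a i j : ℤ} {c : ℝ} (ha : IsNearest ℓ x a) (hij : i + N ≤ j) (hN : 0 ≤ N)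
    (hx : dist (ℓ i) (ℓ j) + dist (ℓ j) x ≤ dist (ℓ i) x + c) (hK : 2 * B + c < 2 * K) :
    j - N ≤ a := by
  have := h.neg.nearest_le hs.neg (i := -j) (j := -i) ha.neg (by omega) hN (c := c) (by
    simp only [neg_neg]
    rw [dist_comm x, dist_comm x, dist_comm (ℓ j) (ℓ i)]
    linarith) hK
  omega

/-- If `x` and `y` project far apart, then the whole stretch of the line between the two
projections is coarsely between `x` and `y`. -/
lemma between₂ (h : IsContractingLine B ℓ) {x y : X} {a b i j : ℤ}
    (ha : IsNearest ℓ x a) (hb : IsNearest ℓ y b) (hai : a ≤ i) (hij : i ≤ j) (hjb : j ≤ b)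
    (hab : B < dist (ℓ a) (ℓ b)) :
    dist x (ℓ i) + dist (ℓ i) (ℓ j) + dist (ℓ j) y ≤ dist x y + 3 * B := by
  have h1 := (h.contracting x y a b ha hb).resolve_left (by linarith)
  have h2 := h.order a i b hai (hij.trans hjb)
  have h3 := h.order i j b hij hjb
  have h4 := dist_triangle x (ℓ a) (ℓ i)
  have h5 := dist_triangle (ℓ j) (ℓ b) y
  linarith

lemma between (h : IsContractingLine B ℓ) {x y : X} {a b i : ℤ}
    (ha : IsNearest ℓ x a) (hb : IsNearest ℓ y b) (hai : a ≤ i) (hib : i ≤ b)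
    (hab : B < dist (ℓ a) (ℓ b)) :
    dist x (ℓ i) + dist (ℓ i) y ≤ dist x y + 3 * B := by
  simpa using h.between₂ ha hb hai le_rfl hib hab

/-- A point `z` coarsely between `x` and `y` whose projection is far from those of `x` and `y` is
near the line. -/
lemma dist_nearest_le_of_separated (h : IsContractingLine B ℓ) {x y z : X} {a b e : ℤ} {c : ℝ}
    (ha : IsNearest ℓ x a) (hb : IsNearest ℓ y b) (he : IsNearest ℓ z e)
    (hae : B < dist (ℓ a) (ℓ e)) (heb : B < dist (ℓ e) (ℓ b))
    (hz : dist x z + dist z y ≤ dist x y + c) :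
    2 * dist z (ℓ e) ≤ 2 * B + c := by
  have h1 := (h.contracting x z a e ha he).resolve_left (by linarith)
  have h2 := (h.contracting z y e b he hb).resolve_left (by linarith)
  have h3 := dist_triangle x (ℓ a) y
  have h4 := dist_triangle (ℓ a) (ℓ e) y
  have h5 := dist_triangle (ℓ e) (ℓ b) y
  have h6 := dist_comm (ℓ e) z
  linarith

end IsContractingLine

end ContractingLines

/-! ### Concatenations of long contracting segments -/

section MarkedSegments

variable {X : Type*}

/-- A pair of points `source`, `target` together with a line, of which the stretch between the
indices `lo` and `hi` is meant to lie between the two points. -/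
structure MarkedSegment (X : Type*) where
  source : X
  target : X
  line : ℤ → X
  lo : ℤ
  hi : ℤ

namespace MarkedSegment

/-- The same segment, travelled in the opposite direction. -/
def rev (s : MarkedSegment X) : MarkedSegment X where
  source := s.target
  target := s.source
  line := fun i => s.line (-i)
  lo := -s.hi
  hi := -s.lo

@[simp] lemma rev_source (s : MarkedSegment X) : s.rev.source = s.target := rfl
@[simp] lemma rev_target (s : MarkedSegment X) : s.rev.target = s.source := rfl
@[simp] lemma rev_line (s : MarkedSegment X) (i : ℤ) : s.rev.line i = s.line (-i) := rfl
@[simp] lemma rev_lo (s : MarkedSegment X) : s.rev.lo = -s.hi := rfl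
@[simp] lemma rev_hi (s : MarkedSegment X) : s.rev.hi = -s.lo := rfl

variable [MetricSpace X]

/-- The line of the segment is contracting, the marked stretch of it is long compared to the
scale `K` (it contains six consecutive stretches of length at least `K`), and this stretch lies
coarsely between the two endpoints. -/
structure IsLong (B K : ℝ) (N : ℤ) (s : MarkedSegment X) : Prop where
  contracting : IsContractingLine B s.line
  sparse : IsSparse K N s.line
  pos : 0 < N
  lo_add_le : s.lo + 6 * N ≤ s.hi
  between : dist s.source (s.line s.lo) + dist (s.line s.lo) (s.line s.hi)
    + dist (s.line s.hi) s.target ≤ dist s.source s.target + B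

/-- Two consecutive segments are coarsely aligned, with error `c`. -/
def Aligned (c : ℝ) (s t : MarkedSegment X) : Prop :=
  dist s.source s.target + dist s.target t.source + dist t.source t.target
    ≤ dist s.source t.target + c

/-- The point `x` is coarsely aligned with the segment `s` and precedes it. -/
def Precedes (c : ℝ) (x : X) (s : MarkedSegment X) : Prop :=
  dist x s.source + dist s.source s.target ≤ dist x s.target + c

/-- The point `y` is coarsely aligned with the segment `s` and follows it. -/
def Follows (c : ℝ) (y : X) (s : MarkedSegment X) : Prop :=
  dist s.source s.target + dist s.target y ≤ dist s.source y + c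

lemma Aligned.rev {c : ℝ} {s t : MarkedSegment X} (h : Aligned c s t) : Aligned c t.rev s.rev := by
  simp only [Aligned, rev_source, rev_target] at *
  rw [dist_comm t.target t.source, dist_comm t.source s.target, dist_comm s.target s.source,
    dist_comm t.target s.source]
  linarith

lemma Follows.rev {c : ℝ} {s : MarkedSegment X} {y : X} (h : Follows c y s) :
    Precedes c y s.rev := by
  simp only [Follows, Precedes, rev_source, rev_target] at *
  rw [dist_comm y s.target, dist_comm s.target s.source, dist_comm y s.source]
  linarith

lemma Precedes.of_rev {c : ℝ} {s : MarkedSegment X} {y : X} (h : Precedes c y s.rev) :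
    Follows c y s := by
  simp only [Follows, Precedes, rev_source, rev_target] at *
  rw [dist_comm y s.target, dist_comm s.target s.source, dist_comm y s.source] at h
  linarith

namespace IsLong

variable {B K c : ℝ} {N : ℤ} {s t : MarkedSegment X}

lemma rev (h : IsLong B K N s) : IsLong B K N s.rev where
  contracting := h.contracting.neg
  sparse := h.sparse.neg
  pos := h.pos
  lo_add_le := by have := h.lo_add_le; simp only [rev_lo, rev_hi]; omega
  between := by
    have := h.between
    simp only [rev_source, rev_target, rev_line, rev_lo, rev_hi, neg_neg]
    rw [dist_comm s.target (s.line s.hi), dist_comm (s.line s.hi) (s.line s.lo),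
      dist_comm (s.line s.lo) s.source, dist_comm s.target s.source]
    linarith

lemma between_line (h : IsLong B K N s) {k : ℤ} (hk : s.lo ≤ k) (hk' : k ≤ s.hi) :
    dist s.source (s.line k) + dist (s.line k) s.target ≤ dist s.source s.target + 2 * B := by
  have h1 := h.between
  have h2 := h.contracting.order _ _ _ hk hk'
  have h3 := dist_triangle s.source (s.line s.lo) (s.line k)
  have h4 := dist_triangle (s.line k) (s.line s.hi) s.target
  linarith

lemma nearest_le (h : IsLong B K N s) {x : X} {a : ℤ} (hx : Precedes c x s)
    (ha : IsNearest s.line x a) (hK : 3 * B + c < 2 * K) : a ≤ s.lo + N := by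
  have hp := h.pos
  refine h.contracting.nearest_le h.sparse ha (j := s.hi) (c := B + c)
    (by have := h.lo_add_le; omega) hp.le ?_ (by linarith)
  have h1 := h.between
  have h2 := dist_triangle x s.source (s.line s.lo)
  have h3 := dist_triangle x (s.line s.hi) s.target
  unfold Precedes at hx
  linarith

lemma le_nearest (h : IsLong B K N s) {y : X} {b : ℤ} (hy : Follows c y s)
    (hb : IsNearest s.line y b) (hK : 3 * B + c < 2 * K) : s.hi - N ≤ b := by
  have := h.rev.nearest_le hy.rev hb.neg hK
  simp only [rev_lo] at this
  omega

/-- The local-to-global step: the error in the conclusion does not depend on how well `x` is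
aligned with `s`, as long as `s` is long enough to absorb it. -/
lemma precedes_of_aligned (hs : IsLong B K N s) {x : X}
    (hx : Precedes (c + 5 * B) x s) (hst : Aligned c s t)
    (hK : 8 * B + c < 2 * K) (hBK : B < K) : Precedes (c + 5 * B) x t := by
  have hB := hs.contracting.nonneg
  have hp := hs.pos
  have hl := hs.lo_add_le
  obtain ⟨a, ha⟩ := hs.contracting.exists_isNearest x
  obtain ⟨e, he⟩ := hs.contracting.exists_isNearest t.target
  have h1 : a ≤ s.lo + N := hs.nearest_le hx ha (by linarith)
  have h2 : s.hi - N ≤ e := by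
    refine hs.le_nearest (c := c) ?_ he (by linarith)
    have := dist_triangle s.target t.source t.target
    unfold Aligned at hst
    unfold Follows
    linarith
  have h3 := hs.contracting.between (i := s.lo + 2 * N) ha he (by omega) (by omega)
    (hBK.trans_le (hs.sparse a e (by omega)))
  have h4 := hs.between_line (k := s.lo + 2 * N) (by omega) (by omega)
  have h5 := dist_triangle s.source (s.line (s.lo + 2 * N)) t.target
  have h6 := dist_triangle (s.line (s.lo + 2 * N)) s.target t.source
  have h7 := dist_triangle x (s.line (s.lo + 2 * N)) t.source
  unfold Precedes
  unfold Aligned at hst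
  linarith

lemma follows_of_aligned (ht : IsLong B K N t) {y : X}
    (hy : Follows (c + 5 * B) y t) (hst : Aligned c s t)
    (hK : 8 * B + c < 2 * K) (hBK : B < K) : Follows (c + 5 * B) y s :=
  (ht.rev.precedes_of_aligned hy.rev hst.rev hK hBK).of_rev

lemma aligned_of_precedes_of_follows (hs : IsLong B K N s) {x y : X}
    (hx : Precedes (c + 5 * B) x s) (hy : Follows (c + 5 * B) y s)
    (hK : 8 * B + c < 2 * K) (hBK : B < K) :
    dist x s.source + dist s.source s.target + dist s.target y
      ≤ dist x y + (2 * c + 17 * B) := by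
  have hp := hs.pos
  have hl := hs.lo_add_le
  obtain ⟨a, ha⟩ := hs.contracting.exists_isNearest x
  obtain ⟨e, he⟩ := hs.contracting.exists_isNearest y
  have h1 : a ≤ s.lo + N := hs.nearest_le hx ha (by linarith)
  have h2 : s.hi - N ≤ e := hs.le_nearest hy he (by linarith)
  have h3 := hs.contracting.between (i := s.lo + 2 * N) ha he (by omega) (by omega)
    (hBK.trans_le (hs.sparse a e (by omega)))
  have h4 := hs.between_line (k := s.lo + 2 * N) (by omega) (by omega)
  have h5 := dist_triangle x (s.line (s.lo + 2 * N)) s.target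
  have h6 := dist_triangle s.source (s.line (s.lo + 2 * N)) y
  have h7 := dist_triangle s.source (s.line (s.lo + 2 * N)) s.target
  unfold Precedes at hx
  unfold Follows at hy
  linarith

end IsLong

end MarkedSegment

end MarkedSegments

/-! ### The discounted distance -/

section DiscountedDistance

variable {X ι : Type*} [MetricSpace X]

/-- The cost of the chain that starts at `x`, travels successively through the segments in the
list, and ends at `y`: its length, with a discount `θ` for each segment used. -/
def chainCost (seg : ι → MarkedSegment X) (θ : ℝ) : X → List ι → X → ℝ
  | x, [], y => dist x y
  | x, i :: l, y => dist x (seg i).source + (dist (seg i).source (seg i).target - θ)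
      + chainCost seg θ (seg i).target l y

/-- The discounted distance: the infimum of the costs of the chains from `x` to `y`. It is not
symmetric, since the segments can be used in one direction only. -/
noncomputable def discountedDist (seg : ι → MarkedSegment X) (θ : ℝ) (x y : X) : ℝ :=
  ⨅ l : List ι, chainCost seg θ x l y

/-- A family of long contracting segments, with a discount that is small compared to the scale
`K`. -/
structure IsDiscountSystem (B K : ℝ) (N : ℤ) (θ : ℝ) (seg : ι → MarkedSegment X) : Prop where
  isLong : ∀ i, (seg i).IsLong B K N
  nonneg : 0 ≤ B
  discount_nonneg : 0 ≤ θ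
  discount_le : ∀ i, θ ≤ dist (seg i).source (seg i).target
  scale : 10 * B + 3 * θ + 10 < 2 * K

namespace IsDiscountSystem

variable {B K θ : ℝ} {N : ℤ} {seg : ι → MarkedSegment X}

lemma rev (h : IsDiscountSystem B K N θ seg) :
    IsDiscountSystem B K N θ (fun i => (seg i).rev) where
  isLong i := (h.isLong i).rev
  nonneg := h.nonneg
  discount_nonneg := h.discount_nonneg
  discount_le i := by
    rw [MarkedSegment.rev_source, MarkedSegment.rev_target, dist_comm]; exact h.discount_le i
  scale := h.scale

lemma chainCost_nonneg (h : IsDiscountSystem B K N θ seg) (x : X) (l : List ι) (y : X) :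
    0 ≤ chainCost seg θ x l y := by
  induction l generalizing x with
  | nil => exact dist_nonneg
  | cons i l ih =>
    have h1 := h.discount_le i
    have h2 := ih (seg i).target
    have h3 := dist_nonneg (x := x) (y := (seg i).source)
    simp only [chainCost]
    linarith

lemma discountedDist_le_chainCost (h : IsDiscountSystem B K N θ seg) (x : X) (l : List ι) (y : X) :
    discountedDist seg θ x y ≤ chainCost seg θ x l y :=
  ciInf_le ⟨0, by rintro _ ⟨l, rfl⟩; exact h.chainCost_nonneg x l y⟩ l

lemma discountedDist_le_dist (h : IsDiscountSystem B K N θ seg) (x y : X) :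
    discountedDist seg θ x y ≤ dist x y :=
  h.discountedDist_le_chainCost x [] y

end IsDiscountSystem

section chainCost

variable {θ : ℝ} {seg : ι → MarkedSegment X}

lemma exists_chainCost_le (seg : ι → MarkedSegment X) (θ : ℝ) (x y : X) {ε : ℝ} (hε : 0 < ε) :
    ∃ l, chainCost seg θ x l y ≤ discountedDist seg θ x y + ε := by
  obtain ⟨l, hl⟩ := exists_lt_of_ciInf_lt
    (lt_add_of_pos_right (⨅ l : List ι, chainCost seg θ x l y) hε)
  exact ⟨l, hl.le⟩

lemma chainCost_append_cons (x y : X) (l₁ l₂ : List ι) (i : ι) :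
    chainCost seg θ x (l₁ ++ i :: l₂) y = chainCost seg θ x l₁ (seg i).source
      + (dist (seg i).source (seg i).target - θ) + chainCost seg θ (seg i).target l₂ y := by
  induction l₁ generalizing x with
  | nil => rfl
  | cons j l ih =>
    simp only [List.cons_append, chainCost, ih]
    ring

lemma chainCost_le_dist_add (x z y : X) (l : List ι) :
    chainCost seg θ x l y ≤ dist x z + chainCost seg θ z l y := by
  cases l with
  | nil => exact dist_triangle _ _ _
  | cons i l =>
    simp only [chainCost]
    linarith [dist_triangle x z (seg i).source]

lemma chainCost_append_le (x z y : X) (l₁ l₂ : List ι) :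
    chainCost seg θ x (l₁ ++ l₂) y ≤ chainCost seg θ x l₁ z + chainCost seg θ z l₂ y := by
  induction l₁ generalizing x with
  | nil => exact chainCost_le_dist_add _ _ _ _
  | cons j l ih =>
    simp only [List.cons_append, chainCost]
    linarith [ih (seg j).target]

lemma chainCost_rev (x y : X) (l : List ι) :
    chainCost (fun i => (seg i).rev) θ y l.reverse x = chainCost seg θ x l y := by
  induction l generalizing x with
  | nil => exact dist_comm _ _
  | cons i l ih =>
    rw [List.reverse_cons, chainCost_append_cons]
    simp only [MarkedSegment.rev_source, MarkedSegment.rev_target, chainCost, ih]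
    rw [dist_comm x, dist_comm (seg i).target]
    ring

lemma discountedDist_rev (x y : X) :
    discountedDist (fun i => (seg i).rev) θ y x = discountedDist seg θ x y :=
  (Function.Surjective.iInf_congr List.reverse List.reverse_surjective
    fun l => chainCost_rev x y l).symm

end chainCost

namespace IsDiscountSystem

variable {B K θ : ℝ} {N : ℤ} {seg : ι → MarkedSegment X}

lemma discountedDist_triangle (h : IsDiscountSystem B K N θ seg) (x z y : X) :
    discountedDist seg θ x y ≤ discountedDist seg θ x z + discountedDist seg θ z y := by
  refine le_of_forall_pos_le_add fun ε hε => ?_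
  obtain ⟨l₁, h₁⟩ := exists_chainCost_le seg θ x z (half_pos hε)
  obtain ⟨l₂, h₂⟩ := exists_chainCost_le seg θ z y (half_pos hε)
  linarith [h.discountedDist_le_chainCost x (l₁ ++ l₂) y,
    chainCost_append_le (seg := seg) (θ := θ) x z y l₁ l₂]

lemma discountedDist_le_add_dist (h : IsDiscountSystem B K N θ seg) (x z y : X) :
    discountedDist seg θ x y ≤ discountedDist seg θ x z + dist z y :=
  (h.discountedDist_triangle x z y).trans (by linarith [h.discountedDist_le_dist z y])

lemma discountedDist_le_dist_add (h : IsDiscountSystem B K N θ seg) (x z y : X) :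
    discountedDist seg θ x y ≤ dist x z + discountedDist seg θ z y :=
  (h.discountedDist_triangle x z y).trans (by linarith [h.discountedDist_le_dist x z])

/-- The cost of using a segment. -/
lemma discountedDist_source_target_le (h : IsDiscountSystem B K N θ seg) (i : ι) :
    discountedDist seg θ (seg i).source (seg i).target
      ≤ dist (seg i).source (seg i).target - θ := by
  simpa [chainCost] using h.discountedDist_le_chainCost (seg i).source [i] (seg i).target

/-- In a coarsely optimal chain that uses the segment `i` and then continues with `l`, any point
that precedes the segment `i` precedes all segments of `l`, with the same error. -/
lemma precedes_of_chain (h : IsDiscountSystem B K N θ seg) {x y : X} {ε : ℝ}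
    (hε : ε ≤ θ + 2 * B + 3) {l : List ι} {i : ι}
    (hi : (seg i).Precedes (2 * θ + ε + 5 * B) x)
    (hl : dist (seg i).source (seg i).target - θ + chainCost seg θ (seg i).target l y
      ≤ discountedDist seg θ (seg i).source y + ε) :
    ∀ j ∈ l, (seg j).Precedes (2 * θ + ε + 5 * B) x := by
  induction l generalizing i with
  | nil => simp
  | cons j l ih =>
    have hB := h.nonneg
    have hθ := h.discount_nonneg
    have hs := h.scale
    simp only [chainCost] at hl
    have hij : (seg i).Aligned (2 * θ + ε) (seg j) := by
      have h1 := h.discountedDist_le_chainCost (seg i).source l y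
      have h2 := chainCost_le_dist_add (seg := seg) (θ := θ) (seg i).source (seg j).target y l
      unfold MarkedSegment.Aligned
      linarith
    have hj : (seg j).Precedes (2 * θ + ε + 5 * B) x :=
      (h.isLong i).precedes_of_aligned hi hij (by linarith) (by linarith)
    have h3 : discountedDist seg θ (seg i).source y ≤ dist (seg i).source (seg i).target - θ
        + (dist (seg i).target (seg j).source + discountedDist seg θ (seg j).source y) :=
      (h.discountedDist_triangle _ (seg i).target _).trans
        (add_le_add (h.discountedDist_source_target_le i) (h.discountedDist_le_dist_add _ _ _))
    simp only [List.mem_cons, forall_eq_or_imp]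
    exact ⟨hj, ih hj (by linarith)⟩

lemma precedes_of_mem (h : IsDiscountSystem B K N θ seg) {x y : X} {ε : ℝ}
    (hε : ε ≤ θ + 2 * B + 3) {l : List ι}
    (hl : chainCost seg θ x l y ≤ discountedDist seg θ x y + ε) {i : ι} (hi : i ∈ l) :
    (seg i).Precedes (2 * θ + ε + 5 * B) x := by
  cases l with
  | nil => simp at hi
  | cons j l =>
    have hB := h.nonneg
    have hθ := h.discount_nonneg
    simp only [chainCost] at hl
    have h1 := h.discountedDist_le_chainCost x l y
    have h2 := chainCost_le_dist_add (seg := seg) (θ := θ) x (seg j).target y l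
    have h3 := h.discountedDist_le_dist_add x (seg j).source y
    have hj : (seg j).Precedes (2 * θ + ε + 5 * B) x := by
      unfold MarkedSegment.Precedes
      linarith
    rcases List.mem_cons.1 hi with rfl | hi
    · exact hj
    · exact h.precedes_of_chain hε hj (by linarith) i hi

lemma follows_of_mem (h : IsDiscountSystem B K N θ seg) {x y : X} {ε : ℝ}
    (hε : ε ≤ θ + 2 * B + 3) {l : List ι}
    (hl : chainCost seg θ x l y ≤ discountedDist seg θ x y + ε) {i : ι} (hi : i ∈ l) :
    (seg i).Follows (2 * θ + ε + 5 * B) y :=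
  (h.rev.precedes_of_mem hε (l := l.reverse) (x := y) (y := x)
    (by rwa [chainCost_rev, discountedDist_rev]) (by simpa using hi)).of_rev

/-- All segments used by a coarsely optimal chain are coarsely aligned with its endpoints, in the
original metric. -/
lemma aligned_of_mem (h : IsDiscountSystem B K N θ seg) {x y : X} {ε : ℝ}
    (hε : ε ≤ θ + 2 * B + 3) {l : List ι}
    (hl : chainCost seg θ x l y ≤ discountedDist seg θ x y + ε) {i : ι} (hi : i ∈ l) :
    dist x (seg i).source + dist (seg i).source (seg i).target + dist (seg i).target y
      ≤ dist x y + (2 * (2 * θ + ε) + 17 * B) := by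
  have hB := h.nonneg
  have hθ := h.discount_nonneg
  have hs := h.scale
  exact (h.isLong i).aligned_of_precedes_of_follows (h.precedes_of_mem hε hl hi)
    (h.follows_of_mem hε hl hi) (by linarith) (by linarith)

/-- A point coarsely between `x` and `y` for the discounted distance is coarsely between them for
the original metric. -/
lemma between_of_discounted_between (h : IsDiscountSystem B K N θ seg) {x y z : X}
    (hz : discountedDist seg θ x z + discountedDist seg θ z y
      ≤ discountedDist seg θ x y + (θ + 1)) :
    dist x z + dist z y ≤ dist x y + (13 * θ + 34 * B + 15) := by
  have hB := h.nonneg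
  have hθ := h.discount_nonneg
  obtain ⟨l₁, h₁⟩ := exists_chainCost_le seg θ x z one_pos
  obtain ⟨l₂, h₂⟩ := exists_chainCost_le seg θ z y one_pos
  -- The chain obtained by removing `z` from the chain through `z` is still coarsely optimal.
  have hl : ∀ x', ∀ l₁', chainCost seg θ x' l₁' z + chainCost seg θ z l₂ y
      ≤ discountedDist seg θ x' y + (θ + 3) →
      chainCost seg θ x' (l₁' ++ l₂) y ≤ discountedDist seg θ x' y + (θ + 3) := fun x' l₁' h' =>
    (chainCost_append_le x' z y l₁' l₂).trans h'
  -- The case in which the chain from the starting point to `z` is a single jump.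
  have key : ∀ x', dist x' z + chainCost seg θ z l₂ y ≤ discountedDist seg θ x' y + (θ + 3) →
      dist x' z + dist z y ≤ dist x' y + (7 * θ + 17 * B + 9) := by
    intro x' hx'
    have h3 := h.discountedDist_le_dist x' y
    cases l₂ with
    | nil =>
      simp only [chainCost] at hx'
      linarith
    | cons j l₂ =>
      have h4 := h.aligned_of_mem (x := x') (y := y) (l := j :: l₂) (ε := θ + 3)
        (by linarith) (hl x' [] hx') (i := j) (by simp)
      simp only [chainCost] at hx'
      have h5 := h.discountedDist_le_chainCost x' (j :: l₂) y
      simp only [chainCost] at h5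
      have h6 := dist_triangle z (seg j).source y
      have h7 := dist_triangle (seg j).source (seg j).target y
      linarith
  rcases List.eq_nil_or_concat l₁ with rfl | ⟨l, i, rfl⟩
  · simp only [chainCost] at h₁
    linarith [key x (by linarith)]
  · rw [List.concat_eq_append] at *
    have h4 := h.aligned_of_mem (x := x) (y := y) (l := l ++ [i] ++ l₂) (ε := θ + 3)
      (by linarith) (hl x _ (by linarith)) (i := i) (by simp)
    rw [chainCost_append_cons] at h₁
    simp only [chainCost] at h₁
    have h5 := h.discountedDist_le_chainCost x l (seg i).source
    have h6 := h.discountedDist_triangle x (seg i).source y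
    have h7 := h.discountedDist_triangle (seg i).source (seg i).target y
    have h8 := h.discountedDist_source_target_le i
    have h9 := key (seg i).target (by linarith)
    have h10 := dist_triangle x (seg i).target z
    have h11 := dist_triangle x (seg i).source (seg i).target
    linarith

/-- A chain from a point outside a set to a point inside it enters the set along a geodesic or
along one of the discounted segments. -/
lemma exists_crossing_of_chain (h : IsDiscountSystem B K N θ seg) (P : X → Prop) {x y : X}
    (hx : ¬ P x) (hy : P y) (l : List ι) :
    ∃ s t, ¬ P s ∧ P t ∧
      discountedDist seg θ x s + (dist s t - θ) + discountedDist seg θ t y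
        ≤ chainCost seg θ x l y := by
  have hθ := h.discount_nonneg
  have h0 : ∀ z, discountedDist seg θ z z ≤ 0 := fun z => by
    simpa using h.discountedDist_le_dist z z
  induction l generalizing x with
  | nil =>
    refine ⟨x, y, hx, hy, ?_⟩
    simp only [chainCost]
    linarith [h0 x, h0 y]
  | cons i l ih =>
    simp only [chainCost]
    have h1 := h.discountedDist_le_chainCost (seg i).target l y
    have h2 := h.discountedDist_source_target_le i
    have h3 := h.discountedDist_le_dist x (seg i).source
    by_cases hu : P (seg i).source
    · refine ⟨x, (seg i).source, hx, hu, ?_⟩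
      linarith [h0 x, h.discountedDist_triangle (seg i).source (seg i).target y]
    by_cases hv : P (seg i).target
    · exact ⟨(seg i).source, (seg i).target, hu, hv, by linarith⟩
    · obtain ⟨s, t, hs, ht, hst⟩ := ih hv
      refine ⟨s, t, hs, ht, ?_⟩
      linarith [h.discountedDist_triangle x (seg i).source s,
        h.discountedDist_triangle (seg i).source (seg i).target s]

end IsDiscountSystem

/-- Going along a geodesic in steps of length at most one, there is a first step entering a given
set. -/
lemma exists_crossing_of_geodesic (hX : IsGeodesicMetricSpace X) (P : X → Prop) {s t : X}
    (hs : ¬ P s) (ht : P t) :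
    ∃ z z', ¬ P z ∧ P z' ∧ dist s z + dist z t = dist s t ∧ dist z z' ≤ 1 := by
  classical
  obtain ⟨σ, c, hc0, hc1, hc, -⟩ := hX s t
  have hmem : ∀ n : ℕ, min (n : ℝ) (dist s t) ∈ Set.Icc 0 (dist s t) := fun n =>
    ⟨le_min n.cast_nonneg dist_nonneg, min_le_right _ _⟩
  have hex : ∃ n : ℕ, P (c (min (n : ℝ) (dist s t))) := by
    obtain ⟨n, hn⟩ := exists_nat_ge (dist s t)
    exact ⟨n, by rwa [min_eq_right hn, hc1]⟩
  obtain ⟨n, hn⟩ : ∃ n, Nat.find hex = n + 1 := by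
    refine Nat.exists_eq_succ_of_ne_zero fun h0 => hs ?_
    have := Nat.find_spec hex
    rwa [h0, Nat.cast_zero, min_eq_left dist_nonneg, hc0] at this
  refine ⟨_, _, Nat.find_min hex (m := n) (by omega), Nat.find_spec hex, ?_, ?_⟩
  · have h1 := hc 0 ⟨le_rfl, dist_nonneg⟩ _ (hmem n)
    have h2 := hc _ (hmem n) (dist s t) ⟨dist_nonneg, le_rfl⟩
    rw [hc0] at h1
    rw [hc1] at h2
    rw [h1, h2, abs_of_nonpos (by linarith [(hmem n).1]), abs_of_nonpos (by linarith [(hmem n).2])]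
    ring
  · rw [hn, hc _ (hmem n) _ (hmem _)]
    push_cast
    rw [abs_le]
    constructor
    · linarith [min_le_min_right (dist s t) (le_refl ((n : ℝ) + 1)),
        min_add_add_right (n : ℝ) (dist s t) 1, min_le_min_left ((n : ℝ) + 1)
          (by linarith : dist s t ≤ dist s t + 1)]
    · linarith [min_le_min_right (dist s t) (by linarith : (n : ℝ) ≤ (n : ℝ) + 1)]

namespace IsDiscountSystem

variable {B K θ : ℝ} {N : ℤ} {seg : ι → MarkedSegment X}

/-- If `x` and `y` project to a contracting line on different sides of `ℓ j`, far from it, then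
`ℓ j` is coarsely between `x` and `y` for the discounted distance. -/
lemma discounted_between (h : IsDiscountSystem B K N θ seg) (hX : IsGeodesicMetricSpace X)
    {ℓ : ℤ → X} (hℓ : IsContractingLine B ℓ) (hs : IsSparse K N ℓ) {x y : X} {a b j : ℤ}
    (ha : IsNearest ℓ x a) (hb : IsNearest ℓ y b) (hN : 0 < N) (haj : a + N ≤ j) (hjb : j + N ≤ b) :
    discountedDist seg θ x (ℓ j) + discountedDist seg θ (ℓ j) y
      ≤ discountedDist seg θ x y + (14 * θ + 40 * B + 18) := by
  have hB := h.nonneg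
  have hθ := h.discount_nonneg
  have hK := h.scale
  choose π hπ using hℓ.exists_isNearest
  -- The set of points having a nearest point on the line that is not before `ℓ j`.
  let P : X → Prop := fun z => ∃ e, j ≤ e ∧ IsNearest ℓ z e
  have hPy : P y := ⟨b, by omega, hb⟩
  have hPx : ¬ P x := by
    rintro ⟨e, hje, he⟩
    have h1 := hℓ.dist_nearest_le ha he
    have h2 := hs a e (by omega)
    simp only [dist_self] at h1
    linarith
  obtain ⟨l, hl⟩ := exists_chainCost_le seg θ x y one_pos
  obtain ⟨s, t, hsP, htP, hst⟩ := h.exists_crossing_of_chain P hPx hPy l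
  obtain ⟨z, z', hz, ⟨e', hje', he'⟩, hzst, hzz⟩ := exists_crossing_of_geodesic hX P hsP htP
  have hez : π z < j := by
    by_contra! hle
    exact hz ⟨_, hle, hπ z⟩
  have h1 : discountedDist seg θ x z + discountedDist seg θ z y
      ≤ discountedDist seg θ x y + (θ + 1) := by
    linarith [h.discountedDist_le_add_dist x s z, h.discountedDist_le_dist_add z t y]
  have h2 := h.between_of_discounted_between h1
  have h3 := hℓ.dist_nearest_le (hπ z) he'
  have h4 := hℓ.order _ _ _ hez.le hje'
  have h5 := hs a j haj
  have h6 := hs j b hjb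
  have h7 := dist_triangle (ℓ a) (ℓ (π z)) (ℓ j)
  have h8 := hℓ.order _ _ _ hez.le (by omega : j ≤ b)
  have h9 : 2 * dist z (ℓ (π z)) ≤ 2 * B + (13 * θ + 34 * B + 15) := by
    refine hℓ.dist_nearest_le_of_separated ha hb (hπ z) ?_ ?_ h2
    · linarith [dist_nonneg (x := ℓ j) (y := ℓ e')]
    · linarith [dist_nonneg (x := ℓ (π z)) (y := ℓ j)]
  have h10 := dist_triangle z (ℓ (π z)) (ℓ j)
  linarith [h.discountedDist_le_add_dist x z (ℓ j), h.discountedDist_le_dist_add (ℓ j) z y,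
    dist_comm (ℓ j) z, dist_nonneg (x := ℓ j) (y := ℓ e')]

end IsDiscountSystem

end DiscountedDistance

/-! ### Antisymmetrization of the discounted distance -/

section Antisymmetrization

variable {X ι : Type*} [MetricSpace X]

/-- The coboundary of the antisymmetrization `D x y - D y x` of a function of two variables. -/
def cyclicSum (D : X → X → ℝ) (x y z : X) : ℝ :=
  (D x y - D y x) + (D y z - D z y) + (D z x - D x z)

/-- The triple `x', y', z'` is a replacement for `x, y, z`: the cyclic sum is changed by a bounded
amount, and none of the six differences `dist - D` increases by more than that amount. -/
structure IsReduction (D : X → X → ℝ) (c : ℝ) (x y z x' y' z' : X) : Prop where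
  cyc : |cyclicSum D x y z - cyclicSum D x' y' z'| ≤ c
  xy : dist x' y' - D x' y' ≤ dist x y - D x y + c
  yx : dist y' x' - D y' x' ≤ dist y x - D y x + c
  yz : dist y' z' - D y' z' ≤ dist y z - D y z + c
  zy : dist z' y' - D z' y' ≤ dist z y - D z y + c
  zx : dist z' x' - D z' x' ≤ dist z x - D z x + c
  xz : dist x' z' - D x' z' ≤ dist x z - D x z + c

namespace IsReduction

variable {D : X → X → ℝ} {c c' : ℝ} {x y z x' y' z' x'' y'' z'' : X}

lemma refl (D : X → X → ℝ) (hc : 0 ≤ c) (x y z : X) : IsReduction D c x y z x y z :=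
  ⟨by simpa, by linarith, by linarith, by linarith, by linarith, by linarith, by linarith⟩

lemma trans (h : IsReduction D c x y z x' y' z') (h' : IsReduction D c' x' y' z' x'' y'' z'') :
    IsReduction D (c + c') x y z x'' y'' z'' :=
  ⟨(abs_sub_le _ _ _).trans (add_le_add h.cyc h'.cyc), by linarith [h.xy, h'.xy],
    by linarith [h.yx, h'.yx], by linarith [h.yz, h'.yz], by linarith [h.zy, h'.zy],
    by linarith [h.zx, h'.zx], by linarith [h.xz, h'.xz]⟩

lemma rotate (h : IsReduction D c x y z x' y' z') : IsReduction D c y z x y' z' x' := by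
  refine ⟨?_, h.yz, h.zy, h.zx, h.xz, h.xy, h.yx⟩
  convert h.cyc using 2
  simp only [cyclicSum]; ring

lemma swap (h : IsReduction D c x y z x' y' z') : IsReduction D c y x z y' x' z' := by
  refine ⟨?_, h.yx, h.xy, h.xz, h.zx, h.zy, h.yz⟩
  rw [← abs_neg]
  convert h.cyc using 2
  simp only [cyclicSum]; ring

end IsReduction

lemma List.exists_eq_append_cons_of_last (P : ι → Prop) (l : List ι) (h : ∃ i ∈ l, P i) :
    ∃ l₁ i l₂, l = l₁ ++ i :: l₂ ∧ P i ∧ ∀ j ∈ l₂, ¬ P j := by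
  induction l with
  | nil => simp at h
  | cons i l ih =>
    by_cases hl : ∃ i ∈ l, P i
    · obtain ⟨l₁, j, l₂, rfl, hj, hl₂⟩ := ih hl
      exact ⟨i :: l₁, j, l₂, rfl, hj, hl₂⟩
    · push Not at hl
      obtain ⟨j, hj, hPj⟩ := h
      rcases List.mem_cons.1 hj with rfl | hj
      · exact ⟨[], j, l, rfl, hPj, hl⟩
      · exact absurd hPj (hl j hj)

namespace IsDiscountSystem

variable {B K θ : ℝ} {N : ℤ} {seg : ι → MarkedSegment X}

/-- If a point of a contracting line coarsely separates `x` from both `y` and `z`, then `x` can be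
replaced by that point. -/
lemma isReduction_of_separated (h : IsDiscountSystem B K N θ seg) (hX : IsGeodesicMetricSpace X)
    {ℓ : ℤ → X} (hℓ : IsContractingLine B ℓ) (hs : IsSparse K N ℓ) {x y z : X} {a b e j : ℤ}
    (ha : IsNearest ℓ x a) (hb : IsNearest ℓ y b) (he : IsNearest ℓ z e) (hN : 0 < N)
    (haj : a + N ≤ j) (hjb : j + N ≤ b) (hje : j + N ≤ e) :
    IsReduction (discountedDist seg θ) (4 * (14 * θ + 40 * B + 18)) x y z (ℓ j) y z := by
  have hB := h.nonneg
  have hθ := h.discount_nonneg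
  have hK := h.scale
  have key : ∀ y b, IsNearest ℓ y b → j + N ≤ b →
      discountedDist seg θ x (ℓ j) + discountedDist seg θ (ℓ j) y
        ≤ discountedDist seg θ x y + (14 * θ + 40 * B + 18) ∧
      discountedDist seg θ y (ℓ j) + discountedDist seg θ (ℓ j) x
        ≤ discountedDist seg θ y x + (14 * θ + 40 * B + 18) ∧
      dist x (ℓ j) + dist (ℓ j) y ≤ dist x y + 3 * B := by
    intro y b hb hjb
    refine ⟨h.discounted_between hX hℓ hs ha hb hN haj hjb, ?_, ?_⟩
    · simpa using h.discounted_between hX hℓ.neg hs.neg (j := -j) hb.neg ha.neg hN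
        (by omega) (by omega)
    · refine hℓ.between ha hb (by omega) (by omega) ?_
      have := hs a b (by omega)
      linarith
  obtain ⟨k1, k2, k3⟩ := key y b hb hjb
  obtain ⟨k4, k5, k6⟩ := key z e he hje
  have t1 := h.discountedDist_triangle x (ℓ j) y
  have t2 := h.discountedDist_triangle y (ℓ j) x
  have t3 := h.discountedDist_triangle x (ℓ j) z
  have t4 := h.discountedDist_triangle z (ℓ j) x
  have u1 := h.discountedDist_le_dist x (ℓ j)
  have u2 := h.discountedDist_le_dist (ℓ j) x
  have c1 := dist_comm (ℓ j) x
  have c2 := dist_comm (ℓ j) y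
  have c3 := dist_comm (ℓ j) z
  have c4 := dist_comm x y
  have c5 := dist_comm x z
  refine ⟨?_, ?_, ?_, ?_, ?_, ?_, ?_⟩
  · simp only [cyclicSum]
    rw [abs_le]
    constructor <;> linarith
  all_goals linarith

/-- Two points of a triple can be replaced in such a way that the discounted distance from the
first to the second becomes coarsely equal to their distance. -/
lemma exists_isReduction (h : IsDiscountSystem B K N θ seg) (hX : IsGeodesicMetricSpace X)
    (x y z : X) :
    ∃ x' y', IsReduction (discountedDist seg θ) (8 * (14 * θ + 40 * B + 18)) x y z x' y' z ∧
      dist x' y' - discountedDist seg θ x' y' ≤ 2 * θ + 4 * B + 1 := by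
  have hB := h.nonneg
  have hθ := h.discount_nonneg
  have hK := h.scale
  have hC : 0 ≤ 4 * (14 * θ + 40 * B + 18) := by linarith
  choose π hπ using fun i => (h.isLong i).contracting.exists_isNearest
  let P : ι → Prop := fun i => (seg i).lo + 3 * N ≤ π i z
  obtain ⟨l, hl⟩ := exists_chainCost_le seg θ x y one_pos
  -- The last segment of an optimal chain for which `z` is not on the side of `x` is used to
  -- replace `x`.
  obtain ⟨x', l', hx', hl', hP⟩ : ∃ x' l',
      IsReduction (discountedDist seg θ) (4 * (14 * θ + 40 * B + 18)) x y z x' y z ∧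
      chainCost seg θ x' l' y ≤ discountedDist seg θ x' y + (θ + 2 * B + 1) ∧
      ∀ j ∈ l', ¬ P j := by
    by_cases hex : ∃ i ∈ l, P i
    · obtain ⟨l₁, i, l₂, rfl, hi, hl₂⟩ := List.exists_eq_append_cons_of_last P l hex
      have hil := h.isLong i
      have hp := hil.pos
      have hlh := hil.lo_add_le
      have h1 := hil.nearest_le (h.precedes_of_mem (by linarith) hl (by simp))
        (hπ i x) (by linarith)
      have h2 := hil.le_nearest (h.follows_of_mem (by linarith) hl (by simp))
        (hπ i y) (by linarith)
      refine ⟨(seg i).line ((seg i).lo + 2 * N), l₂,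
        h.isReduction_of_separated hX hil.contracting hil.sparse (hπ i x) (hπ i y) (hπ i z) hp
          (by omega) (by omega) (by simp only [P] at hi; omega), ?_, hl₂⟩
      rw [chainCost_append_cons] at hl
      have h3 := chainCost_le_dist_add (seg := seg) (θ := θ)
        ((seg i).line ((seg i).lo + 2 * N)) (seg i).target y l₂
      have h4 := hil.between_line (k := (seg i).lo + 2 * N) (by omega) (by omega)
      have h5 := h.discountedDist_le_chainCost x l₁ (seg i).source
      have h6 := h.discountedDist_triangle x (seg i).source y
      have h7 := h.discountedDist_le_dist_add (seg i).source
        ((seg i).line ((seg i).lo + 2 * N)) y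
      linarith
    · push Not at hex
      exact ⟨x, l, IsReduction.refl _ hC x y z, by linarith, hex⟩
  cases l' with
  | nil =>
    refine ⟨x', y, ⟨hx'.cyc.trans ?_, ?_, ?_, ?_, ?_, ?_, ?_⟩, ?_⟩
    · linarith
    · linarith [hx'.xy]
    · linarith [hx'.yx]
    · linarith [hx'.yz]
    · linarith [hx'.zy]
    · linarith [hx'.zx]
    · linarith [hx'.xz]
    · simp only [chainCost] at hl'
      linarith
  | cons j l₂ =>
    -- For the first of the remaining segments, `z` is not on the side of `y`.
    have hj : ¬ P j := hP j (by simp)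
    have hjl := h.isLong j
    have hp := hjl.pos
    have hlh := hjl.lo_add_le
    have h1 := hjl.nearest_le (h.precedes_of_mem (by linarith) hl'
      (List.mem_cons_self ..)) (hπ j x') (by linarith)
    have h2 := hjl.le_nearest (h.follows_of_mem (by linarith) hl'
      (List.mem_cons_self ..)) (hπ j y) (by linarith)
    have hred := h.isReduction_of_separated hX hjl.contracting.neg hjl.sparse.neg
      (j := -((seg j).lo + 4 * N)) (hπ j y).neg (hπ j x').neg (hπ j z).neg hp
      (by omega) (by omega) (by simp only [P] at hj; omega)
    simp only [neg_neg] at hred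
    refine ⟨x', (seg j).line ((seg j).lo + 4 * N), ?_, ?_⟩
    · convert hx'.trans hred.swap using 1
      ring
    · simp only [chainCost] at hl'
      have h3 := h.discountedDist_le_chainCost (seg j).target l₂ y
      have h4 := hjl.between_line (k := (seg j).lo + 4 * N) (by omega) (by omega)
      have h5 := h.discountedDist_triangle x' ((seg j).line ((seg j).lo + 4 * N)) y
      have h6 := h.discountedDist_le_dist_add ((seg j).line ((seg j).lo + 4 * N)) (seg j).target y
      have h7 := dist_triangle x' (seg j).source ((seg j).line ((seg j).lo + 4 * N))
      linarith

/-- The antisymmetrization of the discounted distance is a quasi-cocycle: a triple of points can be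
reduced to one for which all discounted distances are coarsely equal to the distances, and then
all terms of the cyclic sum are bounded. -/
lemma exists_abs_cyclicSum_le (h : IsDiscountSystem B K N θ seg) (hX : IsGeodesicMetricSpace X) :
    ∃ R, ∀ x y z, |cyclicSum (discountedDist seg θ) x y z| ≤ R := by
  obtain ⟨c, hc⟩ : ∃ c, c = 8 * (14 * θ + 40 * B + 18) := ⟨_, rfl⟩
  obtain ⟨e, he⟩ : ∃ e, e = 2 * θ + 4 * B + 1 := ⟨_, rfl⟩
  have hB := h.nonneg
  have hθ := h.discount_nonneg
  have step := h.exists_isReduction hX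
  rw [← hc, ← he] at step
  refine ⟨12 * c + 12 * c + 6 * e + 12 * c, fun x y z => ?_⟩
  obtain ⟨x₁, y₁, r₁, e₁⟩ := step x y z
  obtain ⟨y₂, x₂, r₂, e₂⟩ := step y₁ x₁ z
  obtain ⟨y₃, z₃, r₃, e₃⟩ := step y₂ z x₂
  obtain ⟨z₄, y₄, r₄, e₄⟩ := step z₃ y₃ x₂
  obtain ⟨z₅, x₅, r₅, e₅⟩ := step z₄ x₂ y₄
  obtain ⟨x₆, z₆, r₆, e₆⟩ := step x₅ z₅ y₄
  replace r₂ := r₂.swap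
  replace r₃ := r₃.rotate.rotate
  replace r₄ := r₄.swap.rotate.rotate
  replace r₅ := r₅.rotate
  replace r₆ := r₆.swap.rotate
  have hr := ((((r₁.trans r₂).trans r₃).trans r₄).trans r₅).trans r₆
  have n₁ := h.discountedDist_le_dist x₆ y₄
  have n₂ := h.discountedDist_le_dist y₄ x₆
  have n₃ := h.discountedDist_le_dist y₄ z₆
  have n₄ := h.discountedDist_le_dist z₆ y₄
  have n₅ := h.discountedDist_le_dist z₆ x₆
  have n₆ := h.discountedDist_le_dist x₆ z₆
  have m₁ := (((r₂.trans r₃).trans r₄).trans r₅).trans r₆ |>.xy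
  have m₂ := ((r₃.trans r₄).trans r₅).trans r₆ |>.yx
  have m₃ := (r₄.trans r₅).trans r₆ |>.yz
  have m₄ := r₅.trans r₆ |>.zy
  have m₅ := r₆.zx
  have d₁ := dist_comm x₆ y₄
  have d₂ := dist_comm y₄ z₆
  have d₃ := dist_comm z₆ x₆
  have hcyc := abs_le.1 hr.cyc
  have hc0 : 0 ≤ c := by linarith
  have he0 : 0 ≤ e := by linarith
  have hlast : |cyclicSum (discountedDist seg θ) x₆ y₄ z₆| ≤ 6 * e + 15 * c := by
    simp only [cyclicSum]
    rw [abs_le]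
    constructor <;> linarith
  have := abs_le.1 hlast
  rw [abs_le]
  constructor <;> linarith [hcyc.1, hcyc.2]

end IsDiscountSystem

end Antisymmetrization

/-! ### Axes of rank one elements -/

section Geodesics

variable {X : Type*} [MetricSpace X]

lemma IsGeodesicMetricSpace.exists_dist_eq (hX : IsGeodesicMetricSpace X) {x y : X} {t t' : ℝ}
    (ht : 0 ≤ t) (ht' : 0 ≤ t') (h : t + t' ≤ dist x y) :
    ∃ z z', dist x z = t ∧ dist z y = dist x y - t ∧ dist z' y = t' ∧
      dist z z' = dist x y - t - t' := by
  obtain ⟨σ, c, hc0, hc1, hc, -⟩ := hX x y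
  have h0 : (0 : ℝ) ∈ Set.Icc 0 (dist x y) := ⟨le_rfl, dist_nonneg⟩
  have h1 : dist x y ∈ Set.Icc 0 (dist x y) := ⟨dist_nonneg, le_rfl⟩
  have h2 : t ∈ Set.Icc 0 (dist x y) := ⟨ht, by linarith⟩
  have h3 : dist x y - t' ∈ Set.Icc 0 (dist x y) := ⟨by linarith, by linarith⟩
  have e1 := hc _ h0 _ h2
  have e2 := hc _ h2 _ h1
  have e3 := hc _ h3 _ h1
  have e4 := hc _ h2 _ h3
  rw [hc0] at e1
  rw [hc1] at e2 e3
  refine ⟨c t, c (dist x y - t'), ?_, ?_, ?_, ?_⟩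
  · rw [e1, abs_of_nonpos (by linarith)]; ring
  · rw [e2, abs_of_nonpos (by linarith)]; ring
  · rw [e3, abs_of_nonpos (by linarith)]; ring
  · rw [e4, abs_of_nonpos (by linarith)]; ring

lemma IsGeodesicSegment.isCompact {σ : Set X} {a b : X} (h : IsGeodesicSegment σ a b) :
    IsCompact σ := by
  obtain ⟨c, -, -, hc, rfl⟩ := h
  refine isCompact_Icc.image_of_continuousOn ?_
  refine (LipschitzOnWith.of_dist_le_mul (K := 1) fun s hs t ht => ?_).continuousOn
  rw [hc s hs t ht, Real.dist_eq]
  simp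

lemma IsGeodesicSegment.left_mem {σ : Set X} {a b : X} (h : IsGeodesicSegment σ a b) : a ∈ σ := by
  obtain ⟨c, h0, -, -, rfl⟩ := h
  exact ⟨0, ⟨le_rfl, dist_nonneg⟩, h0⟩

lemma IsGeodesicSegment.dist_add_dist {σ : Set X} {a b u : X} (h : IsGeodesicSegment σ a b)
    (hu : u ∈ σ) : dist a u + dist u b = dist a b := by
  obtain ⟨c, h0, h1, hc, rfl⟩ := h
  obtain ⟨t, ht, rfl⟩ := hu
  have e1 := hc 0 ⟨le_rfl, dist_nonneg⟩ t ht
  have e2 := hc t ht _ ⟨dist_nonneg, le_rfl⟩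
  rw [h0] at e1
  rw [h1] at e2
  rw [e1, e2, abs_of_nonpos (by linarith [ht.1]), abs_of_nonpos (by linarith [ht.2])]
  ring

lemma IsGeodesicSegment.nearestPoints_nonempty {σ : Set X} {a b : X}
    (h : IsGeodesicSegment σ a b) (x : X) : (nearestPoints σ x).Nonempty := by
  obtain ⟨p, hp, hmin⟩ := h.isCompact.exists_isMinOn ⟨a, h.left_mem⟩
    (continuous_const.dist continuous_id : Continuous fun p => dist x p).continuousOn
  exact ⟨p, hp, fun q hq => hmin hq⟩

/-- The geodesic from `x` to `y` is cut at the points where it leaves the largest ball about `x`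
and enters the largest ball about `y` disjoint from `σ`. The contraction of balls controls the two
outer parts, and (DD) controls the middle part. -/
lemma IsContracting.dist_le_or_le {C B : ℝ} (hX : IsGeodesicMetricSpace X) (hC : 0 < C)
    (hDD : AxiomDD X C) {σ : Set X} {a b : X} (hσ : IsGeodesicSegment σ a b)
    (hc : IsContracting B σ) (hB : 0 < B) {x y p q : X} (hp : p ∈ nearestPoints σ x)
    (hq : q ∈ nearestPoints σ y) :
    dist p q ≤ 2 * B + C + 2 ∨
      dist x p + dist p q + dist q y ≤ dist x y + (2 * B + C + 2) := by
  have ball : ∀ {x p z pz : X}, p ∈ nearestPoints σ x → pz ∈ nearestPoints σ z →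
      dist x z < dist x p → dist p pz ≤ B := by
    intro x p z pz hp hpz hz
    have hdisj : Disjoint (Metric.ball x (dist x p)) σ := by
      rw [Set.disjoint_left]
      intro w hw hwσ
      rw [Metric.mem_ball, dist_comm] at hw
      exact absurd (hp.2 w hwσ) (not_le.2 hw)
    refine (Metric.dist_le_diam_of_mem (hσ.isCompact.isBounded.subset ?_) ?_ ?_).trans
      (hc x (dist x p) hdisj).le
    · exact Set.iUnion₂_subset fun w _ v hv => hv.1
    · exact Set.mem_iUnion₂.2 ⟨x, Metric.mem_ball_self (dist_nonneg.trans_lt hz), hp⟩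
    · exact Set.mem_iUnion₂.2 ⟨z, by rwa [Metric.mem_ball, dist_comm], hpz⟩
  have ball' : ∀ {x p z pz : X}, p ∈ nearestPoints σ x → pz ∈ nearestPoints σ z →
      dist x z = max (dist x p - 1) 0 → dist p pz ≤ B := by
    intro x p z pz hp hpz hz
    rcases (dist_nonneg (x := x) (y := p)).eq_or_lt with h0 | h0
    · rw [← h0, max_eq_right (by norm_num), dist_eq_zero] at hz
      subst hz
      have h1 := hpz.2 p hp.1
      have h2 := dist_triangle_left p pz x
      linarith [dist_nonneg (x := x) (y := pz)]
    · exact ball hp hpz (by rw [hz]; exact max_lt (by linarith) h0)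
  obtain ⟨t, ht⟩ : ∃ t, t = max (dist x p - 1) 0 := ⟨_, rfl⟩
  obtain ⟨t', ht'⟩ : ∃ t', t' = max (dist y q - 1) 0 := ⟨_, rfl⟩
  have t0 : 0 ≤ t := ht ▸ le_max_right _ _
  have t0' : 0 ≤ t' := ht' ▸ le_max_right _ _
  have t1 : dist x p - 1 ≤ t := ht ▸ le_max_left _ _
  have t1' : dist y q - 1 ≤ t' := ht' ▸ le_max_left _ _
  rcases le_or_gt (t + t') (dist x y) with hle | hlt
  · obtain ⟨z, z', h1, -, h2, h3⟩ := hX.exists_dist_eq t0 t0' hle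
    obtain ⟨pz, hpz⟩ := hσ.nearestPoints_nonempty z
    obtain ⟨pz', hpz'⟩ := hσ.nearestPoints_nonempty z'
    have h4 := ball' hp hpz (h1.trans ht)
    have h5 := ball' hq hpz' (by rw [dist_comm, h2, ht'])
    have h6 := hDD a b σ hσ z z' pz hpz pz' hpz'
    have h7 := dist_triangle p pz q
    have h8 := dist_triangle pz pz' q
    right
    linarith [dist_comm q y, dist_comm q pz']
  · left
    rcases lt_or_ge (dist x y) (dist x p) with hx | hx
    · linarith [ball hp hq hx]
    rcases lt_or_ge (dist x y) (dist y q) with hy | hy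
    · rw [dist_comm x y] at hy
      linarith [ball hq hp hy, dist_comm p q]
    have htD : t ≤ dist x y := by
      rw [ht]; exact max_le (by linarith) dist_nonneg
    obtain ⟨z, -, h1, h2, -, -⟩ := hX.exists_dist_eq (x := x) (y := y) t0 le_rfl (by linarith)
    obtain ⟨pz, hpz⟩ := hσ.nearestPoints_nonempty z
    have h3 : dist y z < dist y q := by
      rw [dist_comm, h2]
      rcases max_choice (dist y q - 1) 0 with h | h <;> rw [h] at ht' <;> linarith
    have h4 := ball' hp hpz (h1.trans ht)
    have h5 := ball hq hpz h3
    have h6 := dist_triangle p pz q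
    linarith [dist_comm q pz]

end Geodesics

section Axes

variable {Γ X : Type*} [Group Γ] [MulAction Γ X]

/-- The translate by `h` of the orbit of `x₀` under the powers of `g`. -/
def orbitLine (x₀ : X) (h g : Γ) (i : ℤ) : X := h • g ^ i • x₀

lemma orbitLine_neg (x₀ : X) (h g : Γ) : (fun i => orbitLine x₀ h g (-i)) = orbitLine x₀ h g⁻¹ := by
  funext i
  simp [orbitLine]

variable [MetricSpace X] [IsIsometricSMul Γ X]

lemma IsContractingLine.smul {B : ℝ} {ℓ : ℤ → X} (h : IsContractingLine B ℓ) (γ : Γ) :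
    IsContractingLine B (fun i => γ • ℓ i) := by
  have near : ∀ {x a}, IsNearest (fun i => γ • ℓ i) x a → IsNearest ℓ (γ⁻¹ • x) a := by
    intro x a ha j
    have := ha j
    rwa [← dist_smul γ⁻¹ x, ← dist_smul γ⁻¹ x, inv_smul_smul, inv_smul_smul] at this
  refine ⟨fun i j k hij hjk => ?_, fun x => ?_, fun x y a b ha hb => ?_, fun i => ?_⟩
  · simpa only [dist_smul] using h.order i j k hij hjk
  · obtain ⟨a, ha⟩ := h.exists_isNearest (γ⁻¹ • x)
    refine ⟨a, fun j => ?_⟩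
    have := ha j
    rwa [← dist_smul γ, ← dist_smul γ (γ⁻¹ • x), smul_inv_smul] at this
  · have := h.contracting _ _ a b (near ha) (near hb)
    rw [← dist_smul γ (γ⁻¹ • x) (ℓ a), ← dist_smul γ (ℓ b) (γ⁻¹ • y), dist_smul γ⁻¹ x y,
      smul_inv_smul, smul_inv_smul] at this
    simpa only [dist_smul] using this
  · simpa only [dist_smul] using h.dist_succ_le i

lemma IsSparse.smul {K : ℝ} {N : ℤ} {ℓ : ℤ → X} (h : IsSparse K N ℓ) (γ : Γ) :
    IsSparse K N (fun i => γ • ℓ i) := fun i j hij => by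
  simpa only [dist_smul] using h i j hij

lemma dist_orbitLine_one (x₀ : X) (g : Γ) (i j : ℤ) :
    dist (orbitLine x₀ 1 g i) (orbitLine x₀ 1 g j) = dist x₀ (g ^ (j - i) • x₀) := by
  simp only [orbitLine, one_smul]
  rw [← dist_smul (g ^ (-i)) (g ^ i • x₀), smul_smul, smul_smul, ← zpow_add, ← zpow_add]
  simp [neg_add_eq_sub]

lemma IsRankOne.exists_isSparse {x₀ : X} {g : Γ} (h : IsRankOne x₀ g) (K : ℝ) :
    ∃ N₀ : ℤ, 0 < N₀ ∧ ∀ N, N₀ ≤ N → IsSparse K N (orbitLine x₀ 1 g) := by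
  obtain ⟨N, hN⟩ := Filter.eventually_atTop.1 (h.1.eventually_ge_atTop K)
  refine ⟨N + 1, by omega, fun M hM i j hij => ?_⟩
  rw [dist_orbitLine_one]
  have := hN (j - i).toNat (by omega)
  rwa [dist_comm, ← zpow_natCast, Int.toNat_of_nonneg (by omega)] at this

lemma isNearest_orbitLine_shift {x₀ : X} {g : Γ} {x : X} {a : ℤ} (m : ℤ)
    (ha : IsNearest (orbitLine x₀ 1 g) x a) :
    IsNearest (orbitLine x₀ 1 g) (g ^ m • x) (a + m) := fun j => by
  have := ha (j - m)
  rw [← dist_smul (g ^ m), ← dist_smul (g ^ m) x] at this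
  simpa [orbitLine, smul_smul, ← zpow_add, add_comm m] using this

/-- The orbit of the basepoint under the powers of a rank one element is a contracting line. -/
lemma IsRankOne.exists_isContractingLine {C : ℝ} (hX : IsGeodesicMetricSpace X) (hC : 0 < C)
    (hDD : AxiomDD X C) (hFT : AxiomFT X C) {x₀ : X} {g : Γ} (h : IsRankOne x₀ g) :
    ∃ B, IsContractingLine B (orbitLine x₀ 1 g) := by
  obtain ⟨B, hB, hseg⟩ := h.2
  obtain ⟨A, hA⟩ : ∃ A, A = 2 * B + C + 2 := ⟨_, rfl⟩
  obtain ⟨r, hr⟩ : ∃ r, r = 3 * (B + C) + A := ⟨_, rfl⟩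
  have hr0 : 0 ≤ r := by linarith
  have hd0 := dist_nonneg (x := x₀) (y := g • x₀)
  have contr : ∀ x y (a b : ℕ), IsNearest (orbitLine x₀ 1 g) x a →
      IsNearest (orbitLine x₀ 1 g) y b →
      dist (orbitLine x₀ 1 g a) (orbitLine x₀ 1 g b) ≤ A + 4 * r ∨
        dist x (orbitLine x₀ 1 g a) + dist (orbitLine x₀ 1 g a) (orbitLine x₀ 1 g b)
          + dist (orbitLine x₀ 1 g b) y ≤ dist x y + (A + 4 * r) := by
    intro x y a b ha hb
    obtain ⟨⟨σ, hσ, hσB⟩, σ', hσ', hcon⟩ := hseg (a + b + 1) (by omega)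
    -- The nearest points on the contracting segment and on the orbit are close to each other.
    have near : ∀ z (c : ℕ), IsNearest (orbitLine x₀ 1 g) z c → c ≤ a + b + 1 →
        ∃ p ∈ nearestPoints σ' z, dist p (orbitLine x₀ 1 g c) ≤ r := by
      intro z c hc hcn
      obtain ⟨p, hp⟩ := hσ'.nearestPoints_nonempty z
      refine ⟨p, hp, ?_⟩
      obtain ⟨u, hu, hpu⟩ := hFT 0 _ _ _ _ σ σ' (by simp) (by simp) hσ hσ' hp.1
      obtain ⟨_, ⟨k, hk, rfl⟩, huk⟩ := hσB.1 hu
      obtain ⟨v, hv, hcv⟩ := hσB.2 ⟨c, hcn, rfl⟩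
      obtain ⟨w, hw, hvw⟩ := hFT 0 _ _ _ _ σ' σ (by simp) (by simp) hσ' hσ hv
      have e1 : orbitLine x₀ 1 g c = g ^ c • x₀ := by simp [orbitLine]
      have e2 : orbitLine x₀ 1 g k = g ^ k • x₀ := by simp [orbitLine]
      have h1 := hc k
      have h2 := IsContracting.dist_le_or_le hX hC hDD hσ' hcon hB hp
        (⟨hw, fun q _ => by simp⟩ : w ∈ nearestPoints σ' w)
      have h3 := hp.2 w hw
      rw [dist_self] at h2
      rw [e2] at h1
      rw [e1] at h1 ⊢
      have h4 := dist_triangle z (g ^ c • x₀) w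
      have h5 := dist_triangle (g ^ c • x₀) v w
      have h6 := dist_triangle p w (g ^ c • x₀)
      have h7 := dist_triangle z p (g ^ k • x₀)
      have h8 := dist_triangle p u (g ^ k • x₀)
      have h9 := dist_comm w (g ^ c • x₀)
      rcases h2 with h2 | h2 <;> linarith
    obtain ⟨p, hp, hpa⟩ := near x a ha (by omega)
    obtain ⟨q, hq, hqb⟩ := near y b hb (by omega)
    have h1 := dist_triangle (orbitLine x₀ 1 g a) p (orbitLine x₀ 1 g b)
    have h2 := dist_triangle p q (orbitLine x₀ 1 g b)
    have h3 := dist_triangle x p (orbitLine x₀ 1 g a)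
    have h4 := dist_triangle (orbitLine x₀ 1 g b) q y
    have h5 := dist_comm (orbitLine x₀ 1 g a) p
    have h6 := dist_comm (orbitLine x₀ 1 g b) q
    rcases IsContracting.dist_le_or_le hX hC hDD hσ' hcon hB hp hq with h7 | h7
    · left; linarith
    · right; linarith
  refine ⟨A + 4 * r + 2 * B + dist x₀ (g • x₀), ⟨fun i j k hij hjk => ?_, fun x => ?_,
    fun x y a b ha hb => ?_, fun i => ?_⟩⟩
  · simp only [dist_orbitLine_one]
    obtain ⟨m, rfl⟩ := Int.le.dest hij
    obtain ⟨n, rfl⟩ := Int.le.dest hjk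
    have e1 : i + (m : ℤ) - i = (m : ℤ) := by ring
    have e2 : i + (m : ℤ) + n - (i + m) = (n : ℤ) := by ring
    have e3 : i + (m : ℤ) + n - i = ((m + n : ℕ) : ℤ) := by push_cast; ring
    simp only [e1, e2, e3, zpow_natCast]
    rcases Nat.eq_zero_or_pos (m + n) with h0 | h0
    · obtain ⟨rfl, rfl⟩ := Nat.add_eq_zero_iff.1 h0
      simp only [add_zero, pow_zero, one_smul, dist_self]
      linarith
    · obtain ⟨⟨σ, hσ, hσB⟩, -⟩ := hseg (m + n) h0
      obtain ⟨u, hu, hmu⟩ := hσB.2 ⟨m, by omega, rfl⟩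
      have h1 := hσ.dist_add_dist hu
      have h2 := dist_triangle x₀ u (g ^ m • x₀)
      have h3 := dist_triangle (g ^ m • x₀) u (g ^ (m + n) • x₀)
      have h4 : dist x₀ (g ^ n • x₀) = dist (g ^ m • x₀) (g ^ (m + n) • x₀) := by
        rw [pow_add, mul_smul, dist_smul]
      have h5 := dist_comm u (g ^ m • x₀)
      linarith
  · obtain ⟨N, hN, hs⟩ := h.exists_isSparse (2 * dist x (orbitLine x₀ 1 g 0))
    obtain ⟨a, ha, hmin⟩ := Finset.exists_min_image (Finset.Icc (-N) N)
      (fun j => dist x (orbitLine x₀ 1 g j)) ⟨0, by simp; omega⟩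
    refine ⟨a, fun j => ?_⟩
    by_cases hj : j ∈ Finset.Icc (-N) N
    · exact hmin j hj
    · have h1 := hmin 0 (by simp; omega)
      have h2 : 2 * dist x (orbitLine x₀ 1 g 0)
          ≤ dist (orbitLine x₀ 1 g 0) (orbitLine x₀ 1 g j) := by
        rw [Finset.mem_Icc, not_and_or] at hj
        rcases hj with hj | hj
        · rw [dist_comm (orbitLine x₀ 1 g 0) (orbitLine x₀ 1 g j)]
          exact hs N le_rfl j 0 (by omega)
        · exact hs N le_rfl 0 j (by omega)
      linarith [dist_triangle_left (orbitLine x₀ 1 g 0) (orbitLine x₀ 1 g j) x]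
  · -- A translation by a power of `g` makes both indices nonnegative.
    obtain ⟨m, hm⟩ : ∃ m : ℤ, m = |a| + |b| := ⟨_, rfl⟩
    obtain ⟨a', ha'⟩ := Int.eq_ofNat_of_zero_le (a := a + m)
      (by have := neg_abs_le a; have := abs_nonneg b; omega)
    obtain ⟨b', hb'⟩ := Int.eq_ofNat_of_zero_le (a := b + m)
      (by have := neg_abs_le b; have := abs_nonneg a; omega)
    have h1 := contr (g ^ m • x) (g ^ m • y) a' b'
      (by rw [← ha']; exact isNearest_orbitLine_shift m ha)
      (by rw [← hb']; exact isNearest_orbitLine_shift m hb)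
    have e : ∀ k, orbitLine x₀ 1 g (k + m) = g ^ m • orbitLine x₀ 1 g k := fun k => by
      simp [orbitLine, smul_smul, ← zpow_add, add_comm m]
    rw [← ha', ← hb', e, e] at h1
    simp only [dist_smul] at h1
    rcases h1 with h1 | h1
    · left; linarith
    · right; linarith
  · rw [dist_orbitLine_one]
    simp only [add_sub_cancel_left, zpow_one]
    linarith

end Axes

/-! ### Overlapping axes -/

section Overlap

variable {Γ X : Type*} [Group Γ] [MulAction Γ X] [MetricSpace X]

/-- The orbit of the basepoint under the powers of `g` is a contracting line whose points tend to
infinity. -/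
structure IsAxis (B : ℝ) (x₀ : X) (g : Γ) : Prop where
  contracting : IsContractingLine B (orbitLine x₀ 1 g)
  sparse : ∀ K, ∃ N₀ : ℤ, 0 < N₀ ∧ ∀ N, N₀ ≤ N → IsSparse K N (orbitLine x₀ 1 g)

/-- Some translates of the axes of `g` and `h` fellow travel, in the same direction, along
arbitrarily long segments with a uniform constant. -/
def AxesOverlap (x₀ : X) (g h : Γ) : Prop :=
  ∃ R : ℝ, ∀ M : ℕ, ∃ m n : ℕ, M ≤ m ∧ M ≤ n ∧ ∃ γ : Γ,
    dist x₀ (γ • x₀) ≤ R ∧ dist (g ^ m • x₀) (γ • h ^ n • x₀) ≤ R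

namespace IsAxis

variable {B : ℝ} {x₀ : X} {g h : Γ}

lemma mono {B' : ℝ} (hg : IsAxis B x₀ g) (hB : B ≤ B') : IsAxis B' x₀ g :=
  ⟨hg.contracting.mono hB, hg.sparse⟩

lemma inv (hg : IsAxis B x₀ g) : IsAxis B x₀ g⁻¹ := by
  refine ⟨?_, fun K => ?_⟩
  · rw [← orbitLine_neg]; exact hg.contracting.neg
  · obtain ⟨N, hN, h⟩ := hg.sparse K
    refine ⟨N, hN, fun N' hN' => ?_⟩
    rw [← orbitLine_neg]; exact (h N' hN').neg

lemma dist_pow_le (hg : IsAxis B x₀ g) (m : ℕ) : dist x₀ (g ^ m • x₀) ≤ m * B := by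
  simpa [orbitLine] using hg.contracting.dist_le_mul 0 m

lemma exists_forall_le_dist_pow (hg : IsAxis B x₀ g) (K : ℝ) :
    ∃ N : ℕ, ∀ n, N ≤ n → K ≤ dist x₀ (g ^ n • x₀) := by
  obtain ⟨N, hN, h⟩ := hg.sparse K
  refine ⟨N.toNat, fun n hn => ?_⟩
  simpa [orbitLine] using h N le_rfl 0 n (by omega)

lemma exists_forall_le_of_dist_le (hg : IsAxis B x₀ g) (hh : IsAxis B x₀ h) (R : ℝ) (M : ℕ) :
    ∃ M' : ℕ, ∀ m n, M' ≤ n → dist x₀ (h ^ n • x₀) ≤ dist x₀ (g ^ m • x₀) + R → M ≤ m := by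
  obtain ⟨M', hM'⟩ := hh.exists_forall_le_dist_pow (M * B + R + 1)
  refine ⟨M', fun m n hn hd => ?_⟩
  by_contra! hlt
  have h1 := hM' n hn
  have h2 := hg.dist_pow_le m
  have h3 : (m : ℝ) * B ≤ M * B :=
    mul_le_mul_of_nonneg_right (by exact_mod_cast hlt.le) hg.contracting.nonneg
  linarith

variable [IsIsometricSMul Γ X]

lemma contracting_orbitLine (hg : IsAxis B x₀ g) (γ : Γ) :
    IsContractingLine B (orbitLine x₀ γ g) := by
  have : orbitLine x₀ γ g = fun i => γ • orbitLine x₀ 1 g i := by funext i; simp [orbitLine]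
  exact this ▸ hg.contracting.smul γ

lemma isSparse_orbitLine {K : ℝ} {N : ℤ} (hs : IsSparse K N (orbitLine x₀ 1 g)) (γ : Γ) :
    IsSparse K N (orbitLine x₀ γ g) := by
  have : orbitLine x₀ γ g = fun i => γ • orbitLine x₀ 1 g i := by funext i; simp [orbitLine]
  exact this ▸ hs.smul γ

/-- For the axes to overlap it is enough that the second of the two exponents is unbounded. -/
lemma axesOverlap_of_forall_right (hg : IsAxis B x₀ g) (hh : IsAxis B x₀ h) {R : ℝ}
    (H : ∀ M : ℕ, ∃ m n : ℕ, M ≤ n ∧ ∃ γ : Γ,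
      dist x₀ (γ • x₀) ≤ R ∧ dist (g ^ m • x₀) (γ • h ^ n • x₀) ≤ R) :
    AxesOverlap x₀ g h := by
  refine ⟨R, fun M => ?_⟩
  obtain ⟨M', hM'⟩ := hg.exists_forall_le_of_dist_le hh (2 * R) M
  obtain ⟨m, n, hn, γ, h1, h2⟩ := H (max M M')
  refine ⟨m, n, hM' m n ((le_max_right _ _).trans hn) ?_, (le_max_left _ _).trans hn, γ, h1, h2⟩
  have h3 := dist_triangle4 (γ • x₀) x₀ (g ^ m • x₀) (γ • h ^ n • x₀)
  rw [dist_smul, dist_comm (γ • x₀)] at h3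
  linarith

end IsAxis

namespace AxesOverlap

variable [IsIsometricSMul Γ X] {B : ℝ} {x₀ : X} {g h k : Γ}

lemma symm (H : AxesOverlap x₀ g h) : AxesOverlap x₀ h g := by
  obtain ⟨R, H⟩ := H
  refine ⟨R, fun M => ?_⟩
  obtain ⟨m, n, hm, hn, γ, h1, h2⟩ := H M
  refine ⟨n, m, hn, hm, γ⁻¹, ?_, ?_⟩
  · rwa [← dist_smul γ, smul_inv_smul, dist_comm]
  · rwa [← dist_smul γ, smul_inv_smul, dist_comm]

lemma inv (H : AxesOverlap x₀ g h) : AxesOverlap x₀ g⁻¹ h⁻¹ := by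
  obtain ⟨R, H⟩ := H
  refine ⟨R, fun M => ?_⟩
  obtain ⟨m, n, hm, hn, γ, h1, h2⟩ := H M
  refine ⟨m, n, hm, hn, (g ^ m)⁻¹ * γ * h ^ n, ?_, ?_⟩
  · rwa [← dist_smul (g ^ m), smul_smul, ← mul_assoc, mul_inv_cancel_left, mul_smul]
  · rw [← dist_smul (g ^ m), inv_pow, smul_inv_smul, inv_pow, smul_smul, smul_smul]
    simpa [mul_assoc] using h1

/-- The second axis passes near the points of the first one, so that the overlaps can be
restricted to a common segment. -/
lemma trans (hg : IsAxis B x₀ g) (hh : IsAxis B x₀ h) (hk : IsAxis B x₀ k)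
    (H : AxesOverlap x₀ g h) (H' : AxesOverlap x₀ h k) : AxesOverlap x₀ g k := by
  obtain ⟨R, H⟩ := H
  obtain ⟨R', H'⟩ := H'
  have hB := hg.contracting.nonneg
  refine hg.axesOverlap_of_forall_right hk (R := 8 * R + 4 * B + R') fun M => ?_
  obtain ⟨m', n', hm', hn', γ', h3, h4⟩ := H' M
  obtain ⟨m, n, hm, hn, γ, h1, h2⟩ := H m'
  have hR : 0 ≤ R := dist_nonneg.trans h1
  have hR' : 0 ≤ R' := dist_nonneg.trans h3
  -- It suffices to find a point of the axis of `g` near `γ • h ^ m' • x₀`.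
  suffices hsuff : ∃ e : ℕ, dist (g ^ e • x₀) (γ • h ^ m' • x₀) ≤ 8 * R + 4 * B by
    obtain ⟨e, he⟩ := hsuff
    refine ⟨e, n', hn', γ * γ', ?_, ?_⟩
    · have := dist_triangle x₀ (γ • x₀) (γ • γ' • x₀)
      rw [dist_smul] at this
      rw [mul_smul]
      linarith
    · have := dist_triangle (g ^ e • x₀) (γ • h ^ m' • x₀) (γ • γ' • k ^ n' • x₀)
      rw [dist_smul] at this
      rw [mul_smul]
      linarith
  obtain ⟨e, he⟩ := hg.contracting.exists_isNearest (γ • h ^ m' • x₀)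
  have h5 := hh.contracting.order 0 m' n (by omega) (by omega)
  simp only [orbitLine, one_smul, zpow_zero, zpow_natCast] at h5
  rw [← dist_smul γ, ← dist_smul γ (h ^ m' • x₀), ← dist_smul γ x₀ (h ^ n • x₀)] at h5
  have o0 : orbitLine x₀ 1 g 0 = x₀ := by simp [orbitLine]
  have om : ∀ m : ℕ, orbitLine x₀ 1 g m = g ^ m • x₀ := fun m => by simp [orbitLine]
  have h6 : dist (orbitLine x₀ 1 g 0) (γ • h ^ m' • x₀)
      + dist (γ • h ^ m' • x₀) (orbitLine x₀ 1 g m)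
      ≤ dist (orbitLine x₀ 1 g 0) (orbitLine x₀ 1 g m) + (4 * R + B) := by
    rw [o0, om]
    have t1 := dist_triangle x₀ (γ • x₀) (γ • h ^ m' • x₀)
    have t2 := dist_triangle_right (γ • h ^ m' • x₀) (g ^ m • x₀) (γ • h ^ n • x₀)
    have t3 := dist_triangle4 (γ • x₀) x₀ (g ^ m • x₀) (γ • h ^ n • x₀)
    rw [dist_comm (γ • x₀) x₀] at t3
    linarith
  have h7 := hg.contracting.dist_nearest_le_of_between he h6
  rcases le_total 0 e with h0 | h0
  · obtain ⟨e', rfl⟩ := Int.eq_ofNat_of_zero_le h0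
    refine ⟨e', ?_⟩
    rw [om, dist_comm] at h7
    linarith
  · -- If the nearest point lies before the basepoint, then it is near the basepoint.
    refine ⟨0, ?_⟩
    have h8 := hg.contracting.order e 0 m h0 (by omega)
    have h9 := dist_triangle_left (orbitLine x₀ 1 g e) (orbitLine x₀ 1 g m) (γ • h ^ m' • x₀)
    have h10 := dist_triangle_right (orbitLine x₀ 1 g e) (orbitLine x₀ 1 g 0) (γ • h ^ m' • x₀)
    have h11 := dist_triangle (orbitLine x₀ 1 g 0) (orbitLine x₀ 1 g e) (γ • h ^ m' • x₀)
    have h12 := dist_comm (orbitLine x₀ 1 g e) (γ • h ^ m' • x₀)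
    have h13 := dist_comm (orbitLine x₀ 1 g e) (orbitLine x₀ 1 g 0)
    have h14 : dist (orbitLine x₀ 1 g 0) (γ • h ^ m' • x₀) ≤ 8 * R + 4 * B := by linarith
    rw [o0] at h14
    rwa [pow_zero, one_smul]

lemma areEquivalent (hX : IsGeodesicMetricSpace X) {C : ℝ} (hC : 0 < C) (hFT : AxiomFT X C)
    (H : AxesOverlap x₀ g h) : AreEquivalent x₀ g h := by
  obtain ⟨R, H⟩ := H
  choose m n hm hn γ h1 h2 using H
  have hR : 0 ≤ R := dist_nonneg.trans (h1 0)
  refine ⟨C + R, by linarith, m, n, γ, Filter.tendsto_atTop_mono hm Filter.tendsto_id,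
    Filter.tendsto_atTop_mono hn Filter.tendsto_id, fun i =>
    ⟨by linarith [h1 i], by linarith [h2 i], ?_⟩⟩
  obtain ⟨σ, hσ⟩ := hX x₀ (g ^ m i • x₀)
  obtain ⟨τ, hτ⟩ := hX x₀ (h ^ n i • x₀)
  have hτ' : IsGeodesicSegment ((fun x => γ i • x) '' τ) (γ i • x₀) (γ i • h ^ n i • x₀) := by
    obtain ⟨c, hc0, hc1, hc, rfl⟩ := hτ
    refine ⟨fun t => γ i • c t, by simp only [hc0], by simp only [dist_smul, hc1], ?_, ?_⟩
    · simpa only [dist_smul] using hc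
    · rw [dist_smul, Set.image_image]
  exact ⟨σ, τ, hσ, hτ, hFT R _ _ _ _ _ _ (by rw [dist_comm]; exact h1 i)
    (by rw [dist_comm]; exact h2 i) hτ' hσ, hFT R _ _ _ _ _ _ (h1 i) (h2 i) hσ hτ'⟩

end AxesOverlap

/-- At the basepoint, the axes of two independent elements form a coarse geodesic corner. -/
lemma AreIndependent.exists_dist_add_dist_le {B : ℝ} {x₀ : X} {g h : Γ} (hg : IsAxis B x₀ g)
    (hh : IsAxis B x₀ h) (H : AreIndependent x₀ g h) :
    ∃ c, ∀ m n : ℤ, dist (g ^ m • x₀) x₀ + dist x₀ (h ^ n • x₀)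
      ≤ dist (g ^ m • x₀) (h ^ n • x₀) + c := by
  have hfin : {mn : ℤ × ℤ | ¬ 2 * B + 1 ≤ dist (g ^ mn.1 • x₀) (h ^ mn.2 • x₀)}.Finite :=
    H.eventually_ge_atTop (2 * B + 1)
  obtain ⟨R, hR⟩ := (hfin.image fun mn : ℤ × ℤ => dist x₀ (g ^ mn.1 • x₀)).bddAbove
  have hB := hg.contracting.nonneg
  refine ⟨2 * R + B, fun m n => ?_⟩
  have og : ∀ i, orbitLine x₀ 1 g i = g ^ i • x₀ := fun i => by simp [orbitLine]
  have oh : ∀ i, orbitLine x₀ 1 h i = h ^ i • x₀ := fun i => by simp [orbitLine]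
  obtain ⟨a, ha⟩ := hg.contracting.exists_isNearest (h ^ n • x₀)
  obtain ⟨b, hb⟩ := hh.contracting.exists_isNearest (g ^ a • x₀)
  have h1 := hg.contracting.dist_add_dist_nearest_le ha 0
  have h2 := hg.contracting.dist_add_dist_nearest_le ha m
  rw [og, og, zpow_zero, one_smul] at h1
  rw [og, og] at h2
  have h3 := hh.contracting.dist_nearest_le_of_between (i := 0) (j := n) (c := B) hb (by
    rw [oh, oh, zpow_zero, one_smul, dist_comm x₀ (g ^ a • x₀),
      dist_comm (g ^ a • x₀) (h ^ n • x₀), dist_comm x₀ (h ^ n • x₀)]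
    linarith)
  rw [oh] at h3
  have h4 : dist x₀ (g ^ a • x₀) ≤ R :=
    hR ⟨(a, b), by change ¬ 2 * B + 1 ≤ _; linarith, rfl⟩
  have h5 := dist_triangle x₀ (g ^ a • x₀) (h ^ n • x₀)
  have h6 := dist_triangle (g ^ m • x₀) (g ^ a • x₀) x₀
  rw [dist_comm (h ^ n • x₀) (g ^ m • x₀), dist_comm (g ^ a • x₀) (g ^ m • x₀)] at h2
  linarith [dist_comm (h ^ n • x₀) (g ^ a • x₀), dist_comm x₀ (g ^ a • x₀)]

end Overlap

/-! ### Broken geodesics along alternating axes -/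

section Paths

variable {Γ X : Type*} [Group Γ] [MulAction Γ X] [MetricSpace X] [IsIsometricSMul Γ X]

/-- A bound for the length along which translates of the axis of `τ` fellow travel the axis of `g`
in the same direction. -/
def OverlapBound (R : ℝ) (M : ℕ) (x₀ : X) (g τ : Γ) : Prop :=
  ∀ (m n : ℕ) (γ : Γ), dist x₀ (γ • x₀) ≤ R → dist (g ^ m • x₀) (γ • τ ^ n • x₀) ≤ R → n < M

omit [IsIsometricSMul Γ X] in
lemma OverlapBound.mono {R : ℝ} {M M' : ℕ} {x₀ : X} {g τ : Γ} (h : OverlapBound R M x₀ g τ)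
    (hM : M ≤ M') : OverlapBound R M' x₀ g τ :=
  fun m n γ h1 h2 => (h m n γ h1 h2).trans_le hM

lemma exists_overlapBound {B : ℝ} {x₀ : X} (R : ℝ) (F : Finset (Γ × Γ))
    (hF : ∀ p ∈ F, IsAxis B x₀ p.1 ∧ IsAxis B x₀ p.2) :
    ∃ M, ∀ p ∈ F, ¬ AxesOverlap x₀ p.1 p.2 → OverlapBound R M x₀ p.1 p.2 := by
  have h : ∀ p : Γ × Γ, ∃ M, p ∈ F → ¬ AxesOverlap x₀ p.1 p.2 →
      OverlapBound R M x₀ p.1 p.2 := by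
    intro p
    by_cases hp : p ∈ F
    · by_cases ho : AxesOverlap x₀ p.1 p.2
      · exact ⟨0, fun _ h => absurd ho h⟩
      · by_contra! hcon
        refine ho ((hF p hp).1.axesOverlap_of_forall_right (hF p hp).2 (R := R) fun M => ?_)
        have := (hcon M).2.2
        simp only [OverlapBound] at this
        push Not at this
        obtain ⟨m, n, γ, h1, h2, h3⟩ := this
        exact ⟨m, n, h3, γ, h1, h2⟩
    · exact ⟨0, fun h => absurd h hp⟩
  choose f hf using h
  exact ⟨F.sup f, fun p hp ho => (hf p hp ho).mono (Finset.le_sup hp)⟩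

/-- If the endpoints of a segment of a translate of the axis of `g` project to a translate of the
axis of `τ` far from each other and in increasing order, then the two axes fellow travel in the
same direction between the two projections. -/
lemma IsAxis.exists_fellow_travel {B K : ℝ} {N : ℤ} {x₀ : X} {g τ : Γ} (hg : IsAxis B x₀ g)
    (hτ : IsAxis B x₀ τ) (hs : IsSparse K N (orbitLine x₀ 1 τ)) (hK : 20 * B < K) {h γ : Γ}
    {e n : ℕ} {a b i : ℤ} (ha : IsNearest (orbitLine x₀ γ τ) (h • x₀) a)
    (hb : IsNearest (orbitLine x₀ γ τ) ((h * g ^ e) • x₀) b) (hai : a ≤ i)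
    (hn : N ≤ n) (hib : i + n ≤ b) :
    ∃ (m : ℕ) (δ : Γ), dist x₀ (δ • x₀) ≤ 3 * B ∧ dist (g ^ m • x₀) (δ • τ ^ n • x₀) ≤ 3 * B := by
  have hB := hg.contracting.nonneg
  have hℓ := hτ.contracting_orbitLine γ
  have hS := hg.contracting_orbitLine h
  have hs' := IsAxis.isSparse_orbitLine hs γ
  obtain ⟨S, hSdef⟩ : ∃ S, S = orbitLine x₀ h g := ⟨_, rfl⟩
  obtain ⟨ℓ, hℓdef⟩ : ∃ ℓ, ℓ = orbitLine x₀ γ τ := ⟨_, rfl⟩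
  have e0 : h • x₀ = S 0 := by simp [hSdef, orbitLine]
  have e1 : (h * g ^ e) • x₀ = S e := by simp [hSdef, orbitLine, mul_smul]
  rw [← hℓdef] at ha hb hℓ hs'
  rw [← hSdef] at hS
  rw [e0] at ha
  rw [e1] at hb
  have hab : B < dist (ℓ a) (ℓ b) := by linarith [hs' a b (by omega)]
  have hij := hs' i (i + n) (by omega)
  have b2 := hℓ.between₂ ha hb hai (by omega : i ≤ i + n) hib hab
  obtain ⟨e₁, h₁⟩ := hS.exists_isNearest (ℓ i)
  obtain ⟨e₂, h₂⟩ := hS.exists_isNearest (ℓ (i + n))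
  have n1 := hS.dist_nearest_le_of_between h₁ (hℓ.between ha hb hai (by omega) hab)
  have n2 := hS.dist_nearest_le_of_between h₂ (hℓ.between ha hb (by omega) hib hab)
  have hlt : e₁ < e₂ := by
    by_contra! hle
    have t1 := dist_triangle_right (S 0) (S e₁) (ℓ i)
    have t2 := dist_triangle_right (S e₂) (S e) (ℓ (i + n))
    have t3 := dist_triangle4 (ℓ i) (S e₁) (S e₂) (ℓ (i + n))
    have t4 := dist_triangle4 (S e₁) (ℓ i) (ℓ (i + n)) (S e₂)
    have c1 := dist_comm (ℓ i) (S e₁)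
    have c2 := dist_comm (ℓ (i + n)) (S e₂)
    have c3 := dist_comm (ℓ (i + n)) (S e)
    have c4 := dist_comm (S e₁) (S e₂)
    rcases le_total 0 e₂ with h0 | h0
    · have o1 := hS.order 0 e₂ e₁ h0 hle
      have t5 := dist_triangle (S 0) (S e₂) (S e)
      linarith
    rcases le_total e₁ e with h3 | h3
    · have o1 := hS.order e₂ e₁ e hle h3
      have t5 := dist_triangle (S 0) (S e₁) (S e)
      linarith
    · have o1 := hS.order 0 e e₁ (by omega) h3
      have t5 := dist_nonneg (x := S e) (y := S e₁)
      have t6 := dist_nonneg (x := S e₂) (y := S e)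
      linarith
  refine ⟨(e₂ - e₁).toNat, (h * g ^ e₁)⁻¹ * (γ * τ ^ i), ?_, ?_⟩
  · have : dist x₀ (((h * g ^ e₁)⁻¹ * (γ * τ ^ i)) • x₀) = dist (ℓ i) (S e₁) := by
      rw [← dist_smul (h * g ^ e₁), smul_smul, mul_inv_cancel_left, dist_comm, hℓdef, hSdef,
        orbitLine, orbitLine, mul_smul, mul_smul]
    linarith
  · have : dist (g ^ (e₂ - e₁).toNat • x₀)
        (((h * g ^ e₁)⁻¹ * (γ * τ ^ i)) • τ ^ n • x₀) = dist (ℓ (i + n)) (S e₂) := by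
      rw [← dist_smul (h * g ^ e₁), smul_smul (h * g ^ e₁), smul_smul (h * g ^ e₁),
        mul_inv_cancel_left, dist_comm, hℓdef, hSdef, orbitLine, orbitLine, smul_smul, smul_smul,
        mul_assoc γ, mul_assoc h, ← zpow_natCast, ← zpow_natCast,
        Int.toNat_of_nonneg (by omega), ← zpow_add, ← zpow_add, mul_smul, mul_smul,
        add_sub_cancel]
    linarith

/-- The product of the first `k` factors `t i ^ e i`. -/
def partialProd (t : ℕ → Γ) (e : ℕ → ℕ) : ℕ → Γ
  | 0 => 1
  | k + 1 => partialProd t e k * t k ^ e k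

/-- The points `partialProd t e k • x₀` are the break points of a broken geodesic whose pieces
are long segments of translates of axes of the elements `t k`, such that consecutive axes form
coarse geodesic corners. -/
structure IsBrokenPath (B K : ℝ) (N : ℤ) (x₀ : X) (t : ℕ → Γ) (e : ℕ → ℕ) : Prop where
  isAxis : ∀ k, IsAxis B x₀ (t k)
  sparse : ∀ k, IsSparse K N (orbitLine x₀ 1 (t k))
  pos : 0 < N
  le_exponent : ∀ k, 6 * N ≤ e k
  corner : ∀ k, ∀ m n : ℤ, dist (t k ^ m • x₀) x₀ + dist x₀ (t (k + 1) ^ n • x₀)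
    ≤ dist (t k ^ m • x₀) (t (k + 1) ^ n • x₀) + B
  scale : 20 * B < K

/-- The `k`-th piece of a broken path. -/
def brokenPathSegment (x₀ : X) (t : ℕ → Γ) (e : ℕ → ℕ) (k : ℕ) : MarkedSegment X where
  source := partialProd t e k • x₀
  target := partialProd t e (k + 1) • x₀
  line := orbitLine x₀ (partialProd t e k) (t k)
  lo := 0
  hi := e k

namespace IsBrokenPath

variable {B K : ℝ} {N : ℤ} {x₀ : X} {t : ℕ → Γ} {e : ℕ → ℕ}

omit [IsIsometricSMul Γ X] in
lemma nonneg (h : IsBrokenPath B K N x₀ t e) : 0 ≤ B := (h.isAxis 0).contracting.nonneg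

lemma dist_succ (x₀ : X) (t : ℕ → Γ) (e : ℕ → ℕ) (k : ℕ) :
    dist (partialProd t e k • x₀) (partialProd t e (k + 1) • x₀) = dist x₀ (t k ^ e k • x₀) := by
  rw [partialProd, mul_smul, dist_smul]

lemma isLong (h : IsBrokenPath B K N x₀ t e) (k : ℕ) :
    (brokenPathSegment x₀ t e k).IsLong B K N where
  contracting := (h.isAxis k).contracting_orbitLine _
  sparse := IsAxis.isSparse_orbitLine (h.sparse k) _
  pos := h.pos
  lo_add_le := by simpa [brokenPathSegment] using h.le_exponent k
  between := by
    simp only [brokenPathSegment, orbitLine, zpow_zero, one_smul, zpow_natCast, partialProd,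
      mul_smul, dist_self]
    linarith [h.nonneg]

lemma aligned_succ (h : IsBrokenPath B K N x₀ t e) (k : ℕ) :
    (brokenPathSegment x₀ t e k).Aligned B (brokenPathSegment x₀ t e (k + 1)) := by
  have h1 := h.corner k (-(e k)) (e (k + 1))
  rw [← dist_smul (partialProd t e (k + 1)), ← dist_smul (partialProd t e (k + 1)) x₀,
    ← dist_smul (partialProd t e (k + 1)) (t k ^ (-(e k : ℤ)) • x₀)
      (t (k + 1) ^ (e (k + 1) : ℤ) • x₀)] at h1
  have h2 : partialProd t e (k + 1) • t k ^ (-(e k : ℤ)) • x₀ = partialProd t e k • x₀ := by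
    rw [smul_smul, partialProd, mul_assoc, zpow_neg, zpow_natCast, mul_inv_cancel, mul_one]
  have h3 : partialProd t e (k + 1) • t (k + 1) ^ (e (k + 1) : ℤ) • x₀
      = partialProd t e (k + 2) • x₀ := by
    rw [smul_smul, zpow_natCast]; rfl
  rw [h2, h3] at h1
  simp only [MarkedSegment.Aligned, brokenPathSegment, dist_self]
  linarith

lemma precedes (h : IsBrokenPath B K N x₀ t e) {i j : ℕ} (hij : i ≤ j) :
    (brokenPathSegment x₀ t e j).Precedes (B + 5 * B) (partialProd t e i • x₀) := by
  have hB := h.nonneg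
  have hK := h.scale
  induction j, hij using Nat.le_induction with
  | base => simp only [MarkedSegment.Precedes, brokenPathSegment, dist_self]; linarith
  | succ j _ ih =>
    exact (h.isLong j).precedes_of_aligned ih (h.aligned_succ j) (by linarith) (by linarith)

lemma follows (h : IsBrokenPath B K N x₀ t e) {j k : ℕ} (hjk : j < k) :
    (brokenPathSegment x₀ t e j).Follows (B + 5 * B) (partialProd t e k • x₀) := by
  have hB := h.nonneg
  have hK := h.scale
  obtain ⟨d, rfl⟩ := Nat.exists_eq_add_of_lt hjk
  induction d generalizing j with
  | zero => simp only [MarkedSegment.Follows, brokenPathSegment, add_zero, dist_self]; linarith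
  | succ d ih =>
    have := ih (j := j + 1) (by omega)
    rw [show j + 1 + d + 1 = j + (d + 1) + 1 by ring] at this
    exact (h.isLong (j + 1)).follows_of_aligned this (h.aligned_succ j) (by linarith) (by linarith)

/-- The break points are coarsely aligned. -/
lemma dist_add_dist_le (h : IsBrokenPath B K N x₀ t e) {i j k : ℕ} (hij : i ≤ j) (hjk : j ≤ k) :
    dist (partialProd t e i • x₀) (partialProd t e j • x₀)
      + dist (partialProd t e j • x₀) (partialProd t e k • x₀)
      ≤ dist (partialProd t e i • x₀) (partialProd t e k • x₀) + 19 * B := by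
  have hB := h.nonneg
  have hK := h.scale
  rcases hjk.eq_or_lt with rfl | hjk
  · rw [dist_self]; linarith
  · have h1 := (h.isLong j).aligned_of_precedes_of_follows (h.precedes hij) (h.follows hjk)
      (by linarith) (by linarith)
    simp only [brokenPathSegment] at h1
    linarith [dist_triangle (partialProd t e j • x₀) (partialProd t e (j + 1) • x₀)
      (partialProd t e k • x₀)]

/-- A long segment of a translate of the axis of `τ` that lies coarsely between two break points of
the path fellow travels essentially one single piece of the path: since the pieces are long,
otherwise the axis of `τ` would overlap those of two consecutive pieces. -/
lemma exists_overlapping_segment (h : IsBrokenPath B K N x₀ t e) {τ γ : Γ} {M n : ℕ} {lo hi : ℤ}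
    {c : ℝ} (hτ : IsAxis B x₀ τ) (hs : IsSparse K N (orbitLine x₀ 1 τ)) (hNM : N ≤ M)
    (hM : ∀ k, ¬ AxesOverlap x₀ (t k) τ → OverlapBound (3 * B) M x₀ (t k) τ)
    (hne : ∀ k, AxesOverlap x₀ (t k) τ → ¬ AxesOverlap x₀ (t (k + 1)) τ)
    (hlen : ∀ k, (M + 22) * B < dist x₀ (t k ^ e k • x₀)) (hlh : lo + 7 * M ≤ hi)
    (hK : 2 * B + c < 2 * K)
    (hcross : dist x₀ (orbitLine x₀ γ τ lo)
      + dist (orbitLine x₀ γ τ lo) (orbitLine x₀ γ τ hi)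
      + dist (orbitLine x₀ γ τ hi) (partialProd t e n • x₀)
      ≤ dist x₀ (partialProd t e n • x₀) + c) :
    ∃ k a b, k < n ∧ IsNearest (orbitLine x₀ γ τ) (partialProd t e k • x₀) a ∧
      IsNearest (orbitLine x₀ γ τ) (partialProd t e (k + 1) • x₀) b ∧
      a ≤ lo + 3 * M ∧ hi - 3 * M ≤ b ∧ AxesOverlap x₀ (t k) τ := by
  classical
  have hB := h.nonneg
  have hBK := h.scale
  have hN := h.pos
  have hℓ := hτ.contracting_orbitLine γ
  have hs' := IsAxis.isSparse_orbitLine hs γ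
  obtain ⟨ℓ, hℓdef⟩ : ∃ ℓ, ℓ = orbitLine x₀ γ τ := ⟨_, rfl⟩
  obtain ⟨y, hy⟩ : ∃ y : ℕ → X, ∀ k, y k = partialProd t e k • x₀ := ⟨_, fun _ => rfl⟩
  have hy0 : y 0 = x₀ := by rw [hy]; simp [partialProd]
  have align : ∀ {i j k}, i ≤ j → j ≤ k → dist (y i) (y j) + dist (y j) (y k)
      ≤ dist (y i) (y k) + 19 * B := by
    intro i j k hij hjk
    simpa only [hy] using h.dist_add_dist_le hij hjk
  have hlen' : ∀ k, (M + 22) * B < dist (y k) (y (k + 1)) := fun k => by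
    rw [hy, hy, dist_succ]; exact hlen k
  -- A piece whose endpoints project far apart in increasing order overlaps the line.
  have travel : ∀ {k a b}, IsNearest ℓ (y k) a → IsNearest ℓ (y (k + 1)) b → a + M ≤ b →
      AxesOverlap x₀ (t k) τ := by
    intro k a b ha hb hab
    by_contra hno
    rw [hy, hℓdef] at ha hb
    obtain ⟨m, δ, h1, h2⟩ := (h.isAxis k).exists_fellow_travel hτ hs hBK ha hb le_rfl hNM hab
    exact lt_irrefl _ (hM k hno m M δ h1 h2)
  simp only [← hy, ← hℓdef] at hcross hℓ hs' ⊢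
  choose π hπ using hℓ.exists_isNearest
  rw [← hy0] at hcross
  have hstart : π (y 0) ≤ lo + N := by
    refine hℓ.nearest_le hs' (hπ _) (j := hi) (by omega) hN.le (c := c) ?_ hK
    linarith [dist_triangle (y 0) (ℓ hi) (y n)]
  have hend : hi - N ≤ π (y n) := by
    refine hℓ.le_nearest hs' (hπ _) (i := lo) (by omega) hN.le (c := c) ?_ hK
    linarith [dist_triangle (y 0) (ℓ lo) (y n)]
  -- Break points that project to the interior of the segment are near the line.
  have deep : ∀ {k}, k ≤ n → lo + 2 * N ≤ π (y k) → π (y k) ≤ hi - 2 * N →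
      2 * dist (y k) (ℓ (π (y k))) ≤ 21 * B := by
    intro k hk h1 h2
    have := hℓ.dist_nearest_le_of_separated (hπ (y 0)) (hπ (y n)) (hπ (y k))
      (by linarith [hs' (π (y 0)) (π (y k)) (by omega)])
      (by linarith [hs' (π (y k)) (π (y n)) (by omega)]) (align k.zero_le hk)
    linarith
  have short : ∀ {k}, k + 1 ≤ n → lo + 2 * N ≤ π (y k) → π (y k) ≤ hi - 2 * N →
      lo + 2 * N ≤ π (y (k + 1)) → π (y (k + 1)) ≤ hi - 2 * N →
      π (y k) ≤ π (y (k + 1)) + M → π (y (k + 1)) ≤ π (y k) + M → False := by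
    intro k hk h1 h2 h3 h4 h5 h6
    have d1 := deep (by omega) h1 h2
    have d2 := deep hk h3 h4
    have d3 : dist (ℓ (π (y k))) (ℓ (π (y (k + 1)))) ≤ M * B := by
      rcases le_total (π (y k)) (π (y (k + 1))) with hle | hle
      · exact hℓ.dist_le_mul_of_le hle h6
      · rw [dist_comm]; exact hℓ.dist_le_mul_of_le hle h5
    have d4 := dist_triangle4 (y k) (ℓ (π (y k))) (ℓ (π (y (k + 1)))) (y (k + 1))
    have d5 := dist_comm (ℓ (π (y (k + 1)))) (y (k + 1))
    linarith [hlen' k]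
  have hex : ∃ k, lo + 3 * M < π (y k) := ⟨n, by omega⟩
  obtain ⟨k, hk⟩ : ∃ k, Nat.find hex = k + 1 := by
    refine Nat.exists_eq_succ_of_ne_zero fun h0 => ?_
    have := Nat.find_spec hex
    rw [h0] at this
    omega
  have hkn : k + 1 ≤ n := hk ▸ Nat.find_min' hex (by omega)
  have h1 : π (y k) ≤ lo + 3 * M := not_lt.1 (Nat.find_min hex (m := k) (by omega))
  have h2 : lo + 3 * M < π (y (k + 1)) := hk ▸ Nat.find_spec hex
  have h3 : hi - 3 * M ≤ π (y (k + 1)) := by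
    by_contra! hlt
    have hkn' : k + 1 ≠ n := by rintro rfl; omega
    have o1 : AxesOverlap x₀ (t k) τ := by
      by_cases hM' : π (y k) + M ≤ π (y (k + 1))
      · exact travel (hπ _) (hπ _) hM'
      · exact (short hkn (by omega) (by omega) (by omega) (by omega) (by omega) (by omega)).elim
    refine hne k o1 ?_
    by_cases hM' : π (y (k + 1)) + M ≤ π (y (k + 1 + 1))
    · exact travel (hπ _) (hπ _) hM'
    by_cases hM'' : π (y (k + 1)) ≤ π (y (k + 1 + 1)) + M
    · exact (short (k := k + 1) (by omega) (by omega) (by omega) (by omega) (by omega) hM''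
        (by omega)).elim
    · -- Otherwise the path would come back to the line after having left it.
      have d1 := deep hkn (by omega) (by omega)
      have d2 := hℓ.between (i := π (y (k + 1))) (hπ (y (k + 1 + 1))) (hπ (y n)) (by omega) (by omega)
        (by linarith [hs' (π (y (k + 1 + 1))) (π (y n)) (by omega)])
      have d3 := align (i := k + 1) (j := k + 1 + 1) (k := n) (by omega) (by omega)
      have d4 := dist_triangle_right (y (k + 1)) (y (k + 1 + 1)) (ℓ (π (y (k + 1))))
      have d5 := dist_triangle (y (k + 1)) (ℓ (π (y (k + 1)))) (y n)
      have d6 : (M : ℝ) * B ≥ 0 := mul_nonneg M.cast_nonneg hB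
      have d7 := hlen' (k + 1)
      linarith
  exact ⟨k, _, _, by omega, hπ _, hπ _, h1, h3, travel (hπ _) (hπ _) (by omega)⟩

end IsBrokenPath

end Paths

/-! ### Quasi-homomorphisms counting corners -/

section Corners

variable {Γ X : Type*} [Group Γ] [MulAction Γ X] [MetricSpace X]

/-- The corner `g₁ ^ p * g₂ ^ q` translated by `γ`, with the first of its two sides marked. -/
def cornerSegment (x₀ : X) (g₁ g₂ : Γ) (p q : ℕ) (γ : Γ) : MarkedSegment X where
  source := γ • x₀
  target := γ • g₁ ^ p • g₂ ^ q • x₀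
  line := orbitLine x₀ γ g₁
  lo := 0
  hi := p

/-- The function on the group obtained from the antisymmetrized discounted distance, where the
translates of the corner `g₁ ^ p * g₂ ^ q` are discounted. -/
noncomputable def cornerCount (x₀ : X) (g₁ g₂ : Γ) (p q : ℕ) (θ : ℝ) (α : Γ) : ℝ :=
  discountedDist (cornerSegment x₀ g₁ g₂ p q) θ x₀ (α • x₀)
    - discountedDist (cornerSegment x₀ g₁ g₂ p q) θ (α • x₀) x₀

/-- The alternating sequence `g₁, g₂, g₁, g₂, …`. -/
def alternating (g₁ g₂ : Γ) (k : ℕ) : Γ := if Even k then g₁ else g₂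

/-- The sequence of period four `a, b, s, s, a, b, s, s, …`. -/
def blockExponent (a b s k : ℕ) : ℕ := if k % 4 = 0 then a else if k % 4 = 1 then b else s

/-- The product of one period of the factors given by `alternating` and `blockExponent`. -/
def block (g₁ g₂ : Γ) (a b s : ℕ) : Γ := g₁ ^ a * g₂ ^ b * (g₁ ^ s * g₂ ^ s)

omit [MulAction Γ X] [MetricSpace X] in
lemma partialProd_four_mul (g₁ g₂ : Γ) (a b s n : ℕ) :
    partialProd (alternating g₁ g₂) (blockExponent a b s) (4 * n) = block g₁ g₂ a b s ^ n := by
  induction n with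
  | zero => simp [partialProd]
  | succ n ih =>
    have h0 : Even (4 * n) := ⟨2 * n, by ring⟩
    have h1 : ¬ Even (4 * n + 1) := by rw [Nat.even_add_one]; simpa using h0
    have h2 : Even (4 * n + 2) := ⟨2 * n + 1, by ring⟩
    have h3 : ¬ Even (4 * n + 3) := by rw [Nat.even_add_one]; simpa using h2
    have m0 : (4 * n) % 4 = 0 := by omega
    have m1 : (4 * n + 1) % 4 = 1 := by omega
    have m2 : (4 * n + 2) % 4 = 2 := by omega
    have m3 : (4 * n + 3) % 4 = 3 := by omega
    rw [show 4 * (n + 1) = 4 * n + 3 + 1 by ring, partialProd, partialProd, partialProd,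
      partialProd, ih]
    simp only [alternating, blockExponent, if_pos h0, if_neg h1, if_pos h2, if_neg h3, m0, m1, m2,
      m3]
    simp [block, pow_succ, mul_assoc]

/-- Constants for a pair of elements whose axes form coarse geodesic corners and do not overlap:
`B` is the constant of the axes and of the corners, `N` measures the growth of the axes, `M` bounds
all overlaps that are bounded, and the exponents from `s` on are large compared to all of these. -/
structure IsTransversePair (B : ℝ) (N : ℤ) (M s : ℕ) (x₀ : X) (g₁ g₂ : Γ) : Prop where
  isAxis₁ : IsAxis B x₀ g₁
  isAxis₂ : IsAxis B x₀ g₂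
  pos : 0 < N
  sparse₁ : IsSparse (200 * B + 20) N (orbitLine x₀ 1 g₁)
  sparse₂ : IsSparse (200 * B + 20) N (orbitLine x₀ 1 g₂)
  corner : ∀ m n : ℤ, dist (g₁ ^ m • x₀) x₀ + dist x₀ (g₂ ^ n • x₀)
    ≤ dist (g₁ ^ m • x₀) (g₂ ^ n • x₀) + B
  not_overlap : ¬ AxesOverlap x₀ g₁ g₂
  bound : ∀ g ∈ ({g₁, g₂} : Set Γ), ∀ τ ∈ ({g₁, g₁⁻¹, g₂⁻¹} : Set Γ),
    ¬ AxesOverlap x₀ g τ → OverlapBound (3 * B) M x₀ g τ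
  le_bound : N ≤ M
  le_exponent : 6 * N ≤ s
  mul_bound_le : 7 * M ≤ s
  long₁ : ∀ m, s ≤ m → (6 * M + 200) * B + 10 ≤ dist x₀ (g₁ ^ m • x₀)
  long₂ : ∀ m, s ≤ m → (6 * M + 200) * B + 10 ≤ dist x₀ (g₂ ^ m • x₀)

variable [IsIsometricSMul Γ X]

lemma IsContractingLine.dist_le_of_nearest {B K : ℝ} {N : ℤ} {ℓ : ℤ → X}
    (hℓ : IsContractingLine B ℓ) (hs : IsSparse K N ℓ) (hBK : B < K) {M : ℕ} (hNM : N ≤ M)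
    {y y' : X} {a b lo hi : ℤ} (ha : IsNearest ℓ y a) (hb : IsNearest ℓ y' b)
    (hal : a ≤ lo + 3 * M) (hbh : hi - 3 * M ≤ b) (hlh : lo + 7 * M ≤ hi) :
    dist (ℓ lo) (ℓ hi) ≤ dist y y' + (6 * M + 3) * B := by
  have h1 := hℓ.between₂ ha hb hal (by omega) hbh (hBK.trans_le (hs a b (by omega)))
  have h2 := hℓ.dist_le_mul_of_le (i := lo) (j := lo + 3 * M) (M := 3 * M) (by omega)
    (by push_cast; omega)
  have h3 := hℓ.dist_le_mul_of_le (i := hi - 3 * M) (j := hi) (M := 3 * M) (by omega)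
    (by push_cast; omega)
  push_cast at h2 h3
  have h4 := dist_triangle4 (ℓ lo) (ℓ (lo + 3 * M)) (ℓ (hi - 3 * M)) (ℓ hi)
  linarith [dist_nonneg (x := y) (y := ℓ (lo + 3 * M)),
    dist_nonneg (x := ℓ (hi - 3 * M)) (y := y')]

/-- Unless some translate of the discounted segments is aligned with `x` and `y`, no discount is
obtained on the way from `x` to `y`. -/
lemma IsDiscountSystem.exists_aligned_of_discountedDist_lt {ι : Type*} {B K θ : ℝ} {N : ℤ}
    {seg : ι → MarkedSegment X} (h : IsDiscountSystem B K N θ seg) {x y : X}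
    (hxy : discountedDist seg θ x y < dist x y - 1) :
    ∃ i, dist x (seg i).source + dist (seg i).source (seg i).target + dist (seg i).target y
      ≤ dist x y + (2 * (2 * θ + 1) + 17 * B) := by
  have hB := h.nonneg
  have hθ := h.discount_nonneg
  obtain ⟨l, hl⟩ := exists_chainCost_le seg θ x y one_pos
  cases l with
  | nil => simp only [chainCost] at hl; linarith
  | cons i l => exact ⟨i, h.aligned_of_mem (by linarith) hl (List.mem_cons_self ..)⟩

lemma chainCost_smul (x₀ : X) (g₁ g₂ : Γ) (p q : ℕ) (θ : ℝ) (γ : Γ) (x y : X) (l : List Γ) :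
    chainCost (cornerSegment x₀ g₁ g₂ p q) θ (γ • x) (l.map (γ * ·)) (γ • y)
      = chainCost (cornerSegment x₀ g₁ g₂ p q) θ x l y := by
  induction l generalizing x with
  | nil => exact dist_smul γ x y
  | cons i l ih =>
    have := ih (cornerSegment x₀ g₁ g₂ p q i).target
    simp only [cornerSegment, List.map_cons, chainCost, mul_smul, dist_smul] at this ⊢
    rw [this]

lemma discountedDist_smul (x₀ : X) (g₁ g₂ : Γ) (p q : ℕ) (θ : ℝ) (γ : Γ) (x y : X) :
    discountedDist (cornerSegment x₀ g₁ g₂ p q) θ (γ • x) (γ • y)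
      = discountedDist (cornerSegment x₀ g₁ g₂ p q) θ x y :=
  (Function.Surjective.iInf_congr (List.map (γ * ·))
    (List.map_surjective_iff.2 (Group.mulLeft_bijective γ).2)
    fun l => chainCost_smul x₀ g₁ g₂ p q θ γ x y l).symm

namespace IsTransversePair

variable {B : ℝ} {N : ℤ} {M s : ℕ} {x₀ : X} {g₁ g₂ : Γ}

omit [IsIsometricSMul Γ X] in
lemma nonneg (h : IsTransversePair B N M s x₀ g₁ g₂) : 0 ≤ B := h.isAxis₁.contracting.nonneg

lemma dist_corner_le (h : IsTransversePair B N M s x₀ g₁ g₂) (γ : Γ) (p q : ℕ) :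
    dist (γ • x₀) (γ • g₁ ^ p • x₀) + dist (γ • g₁ ^ p • x₀) (γ • g₁ ^ p • g₂ ^ q • x₀)
      ≤ dist (γ • x₀) (γ • g₁ ^ p • g₂ ^ q • x₀) + B := by
  have h1 := h.corner (-p) q
  rw [← dist_smul (g₁ ^ p), ← dist_smul (g₁ ^ p) x₀,
    ← dist_smul (g₁ ^ p) (g₁ ^ (-(p : ℤ)) • x₀) (g₂ ^ (q : ℤ) • x₀)] at h1
  simpa only [dist_smul, zpow_neg, zpow_natCast, smul_inv_smul] using h1

/-- The discount is chosen large enough to compensate for the coarse backtracking at the break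
points of a broken path, so that using a corner on the way does pay off. -/
lemma isDiscountSystem (h : IsTransversePair B N M s x₀ g₁ g₂) {p q : ℕ} (hp : s ≤ p) :
    IsDiscountSystem B (200 * B + 20) N (38 * B + 1) (cornerSegment x₀ g₁ g₂ p q) where
  isLong γ :=
    { contracting := h.isAxis₁.contracting_orbitLine γ
      sparse := IsAxis.isSparse_orbitLine h.sparse₁ γ
      pos := h.pos
      lo_add_le := by
        have := h.le_exponent
        simp only [cornerSegment]
        omega
      between := by
        have := h.dist_corner_le γ p q
        simp only [cornerSegment, orbitLine, zpow_zero, one_smul, zpow_natCast, dist_self]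
        linarith }
  nonneg := h.nonneg
  discount_nonneg := by linarith [h.nonneg]
  discount_le γ := by
    have h1 := h.dist_corner_le γ p q
    have h2 := h.long₁ p hp
    have h3 := mul_nonneg (M.cast_nonneg : (0 : ℝ) ≤ M) h.nonneg
    simp only [dist_smul γ x₀] at h1
    simp only [cornerSegment, dist_smul γ x₀]
    linarith [h.nonneg, dist_nonneg (x := γ • g₁ ^ p • x₀) (y := γ • g₁ ^ p • g₂ ^ q • x₀)]
  scale := by linarith [h.nonneg]

lemma cornerCount_mem (h : IsTransversePair B N M s x₀ g₁ g₂) (hX : IsGeodesicMetricSpace X)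
    {p q : ℕ} (hp : s ≤ p) :
    cornerCount x₀ g₁ g₂ p q (38 * B + 1) ∈ quasiHomomorphisms Γ := by
  obtain ⟨R, hR⟩ := (h.isDiscountSystem (q := q) hp).exists_abs_cyclicSum_le hX
  refine ⟨R, fun α β => ?_⟩
  have h1 := hR x₀ (α • x₀) ((α * β) • x₀)
  rw [← abs_neg] at h1
  convert h1 using 2
  simp only [cyclicSum, cornerCount, mul_smul, discountedDist_smul]
  ring

omit [IsIsometricSMul Γ X] in
lemma isAxis_alternating (h : IsTransversePair B N M s x₀ g₁ g₂) (k : ℕ) :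
    IsAxis B x₀ (alternating g₁ g₂ k) := by
  unfold alternating; split_ifs
  exacts [h.isAxis₁, h.isAxis₂]

lemma le_blockExponent {a b : ℕ} (ha : s ≤ a) (hb : s ≤ b) (k : ℕ) :
    s ≤ blockExponent a b s k := by
  unfold blockExponent; split_ifs <;> omega

omit [IsIsometricSMul Γ X] in
lemma long_alternating (h : IsTransversePair B N M s x₀ g₁ g₂) (k : ℕ) {m : ℕ} (hm : s ≤ m) :
    (6 * M + 200) * B + 10 ≤ dist x₀ (alternating g₁ g₂ k ^ m • x₀) := by
  unfold alternating; split_ifs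
  exacts [h.long₁ m hm, h.long₂ m hm]

omit [IsIsometricSMul Γ X] in
lemma isBrokenPath (h : IsTransversePair B N M s x₀ g₁ g₂) {a b : ℕ} (ha : s ≤ a) (hb : s ≤ b) :
    IsBrokenPath B (200 * B + 20) N x₀ (alternating g₁ g₂) (blockExponent a b s) where
  isAxis := h.isAxis_alternating
  sparse k := by
    unfold alternating; split_ifs
    exacts [h.sparse₁, h.sparse₂]
  pos := h.pos
  le_exponent k := by
    have h1 := h.le_exponent
    have h2 := le_blockExponent ha hb k
    omega
  corner k m n := by
    by_cases hk : Even k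
    · simp only [alternating, if_pos hk, if_neg (by rw [Nat.even_add_one]; simpa using hk :
        ¬ Even (k + 1))]
      exact h.corner m n
    · simp only [alternating, if_neg hk, if_pos (by rw [Nat.even_add_one]; simpa using hk :
        Even (k + 1))]
      have := h.corner n m
      rw [dist_comm (g₂ ^ m • x₀) x₀, dist_comm x₀ (g₁ ^ n • x₀),
        dist_comm (g₂ ^ m • x₀) (g₁ ^ n • x₀)]
      linarith
  scale := by linarith [h.nonneg]

/-- No axis overlaps the axes of both elements. -/
lemma not_overlap_both (h : IsTransversePair B N M s x₀ g₁ g₂) {τ : Γ} (hτ : IsAxis B x₀ τ)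
    (h₁ : AxesOverlap x₀ g₁ τ) (h₂ : AxesOverlap x₀ g₂ τ) : False :=
  h.not_overlap (h₁.trans h.isAxis₁ hτ h.isAxis₂ h₂.symm)

/-- A long segment of an axis that is aligned with two points of a broken path overlaps a piece of
the path which is almost as long. -/
lemma exists_overlapping_segment (h : IsTransversePair B N M s x₀ g₁ g₂) {a b : ℕ} (ha : s ≤ a)
    (hb : s ≤ b) {τ γ : Γ} (hτ : τ ∈ ({g₁, g₁⁻¹, g₂⁻¹} : Set Γ)) {lo hi : ℤ} (hlh : lo + s ≤ hi)
    {n : ℕ}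
    (hcross : dist x₀ (orbitLine x₀ γ τ lo)
      + dist (orbitLine x₀ γ τ lo) (orbitLine x₀ γ τ hi)
      + dist (orbitLine x₀ γ τ hi)
        (partialProd (alternating g₁ g₂) (blockExponent a b s) n • x₀)
      ≤ dist x₀ (partialProd (alternating g₁ g₂) (blockExponent a b s) n • x₀)
        + (170 * B + 6)) :
    ∃ k i j, k < n ∧
      IsNearest (orbitLine x₀ γ τ)
        (partialProd (alternating g₁ g₂) (blockExponent a b s) k • x₀) i ∧
      IsNearest (orbitLine x₀ γ τ)
        (partialProd (alternating g₁ g₂) (blockExponent a b s) (k + 1) • x₀) j ∧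
      i ≤ lo + 3 * M ∧ hi - 3 * M ≤ j ∧ AxesOverlap x₀ (alternating g₁ g₂ k) τ ∧
      dist (orbitLine x₀ γ τ lo) (orbitLine x₀ γ τ hi)
        ≤ dist x₀ (alternating g₁ g₂ k ^ blockExponent a b s k • x₀) + (6 * M + 3) * B := by
  have hB := h.nonneg
  have hMB : 0 ≤ (M : ℝ) * B := mul_nonneg M.cast_nonneg hB
  have hMs := h.mul_bound_le
  have hP := h.isBrokenPath ha hb
  have hτ' : IsAxis B x₀ τ ∧ IsSparse (200 * B + 20) N (orbitLine x₀ 1 τ) := by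
    rcases hτ with rfl | rfl | rfl
    · exact ⟨h.isAxis₁, h.sparse₁⟩
    · exact ⟨h.isAxis₁.inv, by rw [← orbitLine_neg]; exact h.sparse₁.neg⟩
    · exact ⟨h.isAxis₂.inv, by rw [← orbitLine_neg]; exact h.sparse₂.neg⟩
  obtain ⟨k, i, j, hk, hi', hj, h1, h2, h3⟩ := hP.exists_overlapping_segment hτ'.1 hτ'.2
    h.le_bound (fun k => h.bound _ (by unfold alternating; split_ifs <;> simp) τ hτ) (fun k h1 h2 => by
      by_cases hk : Even k
      · simp only [alternating, if_pos hk, if_neg (by rw [Nat.even_add_one]; simpa using hk :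
          ¬ Even (k + 1))] at h1 h2
        exact h.not_overlap_both hτ'.1 h1 h2
      · simp only [alternating, if_neg hk, if_pos (by rw [Nat.even_add_one]; simpa using hk :
          Even (k + 1))] at h1 h2
        exact h.not_overlap_both hτ'.1 h2 h1)
    (fun k => by linarith [h.long_alternating k (le_blockExponent ha hb k)])
    (by omega) (by linarith) hcross
  refine ⟨k, i, j, hk, hi', hj, h1, h2, h3, ?_⟩
  rw [← IsBrokenPath.dist_succ x₀ (alternating g₁ g₂)]
  exact (hτ'.1.contracting_orbitLine γ).dist_le_of_nearest (IsAxis.isSparse_orbitLine hτ'.2 γ)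
    (by linarith) h.le_bound hi' hj h1 h2 (by omega)

end IsTransversePair

end Corners

/-! ### Corners along broken paths -/

section Detection

variable {Γ X : Type*} [Group Γ] [MulAction Γ X] [MetricSpace X] [IsIsometricSMul Γ X]

namespace IsTransversePair

variable {B : ℝ} {N : ℤ} {M s : ℕ} {x₀ : X} {g₁ g₂ : Γ}

/-- The two sides of a translated corner that is aligned with `x` and `y`. -/
lemma dist_sides_le (h : IsTransversePair B N M s x₀ g₁ g₂) {p q : ℕ} {γ : Γ} {x y : X}
    (hγ : dist x (γ • x₀) + dist (γ • x₀) (γ • g₁ ^ p • g₂ ^ q • x₀)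
      + dist (γ • g₁ ^ p • g₂ ^ q • x₀) y ≤ dist x y + (2 * (2 * (38 * B + 1) + 1) + 17 * B)) :
    dist x (γ • x₀) + dist (γ • x₀) (γ • g₁ ^ p • x₀)
      + dist (γ • g₁ ^ p • x₀) (γ • g₁ ^ p • g₂ ^ q • x₀)
      + dist (γ • g₁ ^ p • g₂ ^ q • x₀) y ≤ dist x y + (170 * B + 6) := by
  linarith [h.dist_corner_le γ p q]

/-- If the first side of the discounted corner is much longer than all pieces of the broken path,
then no discount is obtained along the path, in either direction: a side of a corner along the path
would overlap a piece of the path of about the same length. -/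
lemma abs_cornerCount_le (h : IsTransversePair B N M s x₀ g₁ g₂) {a b p q : ℕ} (ha : s ≤ a)
    (hb : s ≤ b) (hp : s ≤ p)
    (hlen : ∀ k, dist x₀ (alternating g₁ g₂ k ^ blockExponent a b s k • x₀)
      + (6 * M + 3) * B < dist x₀ (g₁ ^ p • x₀)) (n : ℕ) :
    |cornerCount x₀ g₁ g₂ p q (38 * B + 1)
      (partialProd (alternating g₁ g₂) (blockExponent a b s) n)| ≤ 1 := by
  have hD := h.isDiscountSystem (q := q) hp
  obtain ⟨y, hy⟩ : ∃ y, y = partialProd (alternating g₁ g₂) (blockExponent a b s) n • x₀ :=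
    ⟨_, rfl⟩
  have h1 : dist x₀ y - 1 ≤ discountedDist (cornerSegment x₀ g₁ g₂ p q) (38 * B + 1) x₀ y := by
    by_contra! hlt
    obtain ⟨γ, hγ⟩ := hD.exists_aligned_of_discountedDist_lt hlt
    have hγ' := h.dist_sides_le hγ
    have t1 := dist_triangle (γ • g₁ ^ p • x₀) (γ • g₁ ^ p • g₂ ^ q • x₀) y
    have o0 : orbitLine x₀ γ g₁ 0 = γ • x₀ := by simp [orbitLine]
    have op : orbitLine x₀ γ g₁ p = γ • g₁ ^ p • x₀ := by simp [orbitLine]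
    obtain ⟨k, -, -, -, -, -, -, -, -, h2⟩ := h.exists_overlapping_segment ha hb (τ := g₁)
      (γ := γ) (lo := 0) (hi := p) (n := n) (by simp) (by omega) (by
        rw [← hy, o0, op]; linarith)
    rw [o0, op, dist_smul] at h2
    linarith [hlen k]
  have h2 : dist y x₀ - 1 ≤ discountedDist (cornerSegment x₀ g₁ g₂ p q) (38 * B + 1) y x₀ := by
    by_contra! hlt
    obtain ⟨γ, hγ⟩ := hD.exists_aligned_of_discountedDist_lt hlt
    have hγ' := h.dist_sides_le hγ
    have t1 := dist_triangle (γ • g₁ ^ p • x₀) (γ • g₁ ^ p • g₂ ^ q • x₀) x₀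
    have o0 : orbitLine x₀ γ g₁⁻¹ 0 = γ • x₀ := by simp [orbitLine]
    have op : orbitLine x₀ γ g₁⁻¹ (-(p : ℤ)) = γ • g₁ ^ p • x₀ := by simp [orbitLine]
    obtain ⟨k, -, -, -, -, -, -, -, -, h2⟩ := h.exists_overlapping_segment ha hb (τ := g₁⁻¹)
      (γ := γ) (lo := -p) (hi := 0) (n := n) (by simp) (by omega) (by
        rw [← hy, o0, op, dist_comm x₀, dist_comm (γ • g₁ ^ p • x₀) (γ • x₀),
          dist_comm (γ • x₀) y, dist_comm x₀ y]
        linarith)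
    rw [o0, op, dist_comm (γ • g₁ ^ p • x₀), dist_smul] at h2
    linarith [hlen k]
  have h3 := hD.discountedDist_le_dist x₀ y
  have h4 := hD.discountedDist_le_dist y x₀
  have h5 := dist_comm x₀ y
  rw [cornerCount, ← hy, abs_le]
  constructor <;> linarith

/-- The corner `g₁ ^ p * g₂ ^ q` cannot be found along the path with exponents `p, q, s, s, …` in
the backward direction, if `s`, `p` and `q` have quite different sizes. Its long side would overlap
a piece `g₂ ^ q` in the opposite direction. Since `g₂` then overlaps its inverse, the inverse of
`g₁` does not overlap `g₂`, and therefore the short side overlaps a piece `g₁ ^ p`. But the pieces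
`g₂ ^ q` and `g₁ ^ p` are not adjacent in the order needed. -/
lemma dist_sub_one_le_discountedDist (h : IsTransversePair B N M s x₀ g₁ g₂) {p q : ℕ}
    (hp : s ≤ p) (hq : s ≤ q)
    (hp₁ : dist x₀ (g₁ ^ s • x₀) + (6 * M + 3) * B < dist x₀ (g₁ ^ p • x₀))
    (hp₂ : dist x₀ (g₂ ^ s • x₀) + (6 * M + 3) * B < dist x₀ (g₁ ^ p • x₀))
    (hq₁ : dist x₀ (g₁ ^ p • x₀) + (6 * M + 3) * B < dist x₀ (g₂ ^ q • x₀)) (n : ℕ) :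
    dist (partialProd (alternating g₁ g₂) (blockExponent p q s) n • x₀) x₀ - 1
      ≤ discountedDist (cornerSegment x₀ g₁ g₂ p q) (38 * B + 1)
        (partialProd (alternating g₁ g₂) (blockExponent p q s) n • x₀) x₀ := by
  have hB := h.nonneg
  have hMB : 0 ≤ (M : ℝ) * B := mul_nonneg M.cast_nonneg hB
  have hMs := h.mul_bound_le
  have hN := h.pos
  have hNM := h.le_bound
  have hP := h.isBrokenPath hp hq
  have hD := h.isDiscountSystem (q := q) hp
  obtain ⟨y, hy⟩ : ∃ y : ℕ → X, ∀ n,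
    y n = partialProd (alternating g₁ g₂) (blockExponent p q s) n • x₀ := ⟨_, fun _ => rfl⟩
  have hy0 : y 0 = x₀ := by rw [hy]; simp [partialProd]
  rw [← hy]
  by_contra! hlt
  obtain ⟨γ, hγ⟩ := hD.exists_aligned_of_discountedDist_lt hlt
  have hγ' := h.dist_sides_le hγ
  have hlong := h.long₁ p hp
  obtain ⟨u, hu⟩ : ∃ u, u = γ • x₀ := ⟨_, rfl⟩
  obtain ⟨m, hm⟩ : ∃ m, m = γ • g₁ ^ p • x₀ := ⟨_, rfl⟩
  obtain ⟨v, hv⟩ : ∃ v, v = γ • g₁ ^ p • g₂ ^ q • x₀ := ⟨_, rfl⟩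
  have hum : dist m u = dist x₀ (g₁ ^ p • x₀) := by rw [hu, hm, dist_smul, dist_comm]
  have hmv : dist v m = dist x₀ (g₂ ^ q • x₀) := by
    rw [hv, hm, dist_smul, dist_smul, dist_comm]
  have huv := h.dist_corner_le γ p q
  rw [← hu, ← hm, ← hv] at hγ' huv
  rw [dist_comm (y n) u, dist_comm u m, dist_comm m v, dist_comm v x₀, dist_comm (y n) x₀,
    ← hy0] at hγ'
  rw [dist_comm u m, dist_comm m v, dist_comm u v] at huv
  have align : ∀ {i j k}, i ≤ j → j ≤ k → dist (y i) (y j) + dist (y j) (y k)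
      ≤ dist (y i) (y k) + 19 * B := by
    intro i j k hij hjk
    simpa only [hy] using hP.dist_add_dist_le hij hjk
  -- The two sides of the corner, in the backward direction.
  obtain ⟨β, hβ⟩ : ∃ β, β = orbitLine x₀ (γ * g₁ ^ p) g₂⁻¹ := ⟨_, rfl⟩
  obtain ⟨α, hα⟩ : ∃ α, α = orbitLine x₀ γ g₁⁻¹ := ⟨_, rfl⟩
  have β0 : β 0 = m := by simp [hβ, orbitLine, hm, mul_smul]
  have βq : β (-(q : ℤ)) = v := by simp [hβ, orbitLine, hv, mul_smul]
  have α0 : α 0 = u := by simp [hα, orbitLine, hu]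
  have αp : α (-(p : ℤ)) = m := by simp [hα, orbitLine, hm]
  obtain ⟨k, i, j, hk, hi, hj, hi', hj', ho, hd⟩ := h.exists_overlapping_segment hp hq
    (τ := g₂⁻¹) (γ := γ * g₁ ^ p) (lo := -q) (hi := 0) (n := n) (by simp) (by omega) (by
      rw [← hβ, β0, βq, ← hy, ← hy0]
      linarith [dist_triangle m u (y n)])
  obtain ⟨k', i', j', hk', hi₂, hj₂, hi₂', hj₂', ho', hd'⟩ := h.exists_overlapping_segment hp hq
    (τ := g₁⁻¹) (γ := γ) (lo := -p) (hi := 0) (n := n) (by simp) (by omega) (by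
      rw [← hα, α0, αp, ← hy, ← hy0]
      linarith [dist_triangle (y 0) v m])
  rw [← hβ, β0, βq, hmv] at hd
  rw [← hα, α0, αp, hum] at hd'
  rw [← hβ, ← hy] at hi hj
  rw [← hα, ← hy] at hi₂ hj₂
  have hkmod : k % 4 = 1 := by
    by_contra hne
    unfold alternating blockExponent at hd
    split_ifs at hd with h1 <;> first | linarith | (rw [Nat.even_iff] at h1; omega)
  have hkodd : ¬ Even k := by rw [Nat.even_iff]; omega
  rw [alternating, if_neg hkodd] at ho
  have hkmod' : k' % 4 = 0 := by
    by_cases hev : Even k'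
    · by_contra hne
      unfold alternating blockExponent at hd'
      rw [if_pos hev, if_neg hne, if_neg (by rw [Nat.even_iff] at hev; omega)] at hd'
      linarith
    · rw [alternating, if_neg hev] at ho'
      have h1 := (ho'.symm.trans h.isAxis₁.inv h.isAxis₂ h.isAxis₂.inv ho).inv
      rw [inv_inv, inv_inv] at h1
      exact absurd h1 h.not_overlap
  have hαl : IsContractingLine B α := hα ▸ h.isAxis₁.inv.contracting_orbitLine γ
  have hβl : IsContractingLine B β := hβ ▸ h.isAxis₂.inv.contracting_orbitLine (γ * g₁ ^ p)
  have hαs : IsSparse (200 * B + 20) N α := by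
    rw [hα]
    exact IsAxis.isSparse_orbitLine (by rw [← orbitLine_neg]; exact h.sparse₁.neg) γ
  have hβs : IsSparse (200 * B + 20) N β := by
    rw [hβ]
    exact IsAxis.isSparse_orbitLine (by rw [← orbitLine_neg]; exact h.sparse₂.neg) (γ * g₁ ^ p)
  obtain ⟨a₀, ha₀⟩ := hαl.exists_isNearest (y 0)
  obtain ⟨a₁, ha₁⟩ := hαl.exists_isNearest (y n)
  obtain ⟨b₀, hb₀⟩ := hβl.exists_isNearest (y 0)
  obtain ⟨b₁, hb₁⟩ := hβl.exists_isNearest (y n)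
  have ha₀' : a₀ ≤ -p + N := by
    refine hαl.nearest_le hαs ha₀ (j := 0) (by omega) hN.le (c := 170 * B + 6) ?_ (by linarith)
    rw [α0, αp]
    linarith [dist_triangle (y 0) v m, dist_triangle (y 0) u (y n)]
  have ha₁' : 0 - N ≤ a₁ := by
    refine hαl.le_nearest hαs ha₁ (i := -p) (by omega) hN.le (c := 170 * B + 6) ?_ (by linarith)
    rw [α0, αp]
    linarith [dist_triangle (y 0) v m, dist_triangle (y 0) m (y n)]
  have hb₀' : b₀ ≤ -q + N := by
    refine hβl.nearest_le hβs hb₀ (j := 0) (by omega) hN.le (c := 170 * B + 6) ?_ (by linarith)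
    rw [β0, βq]
    linarith [dist_triangle m u (y n), dist_triangle (y 0) m (y n)]
  have hb₁' : 0 - N ≤ b₁ := by
    refine hβl.le_nearest hβs hb₁ (i := -q) (by omega) hN.le (c := 170 * B + 6) ?_ (by linarith)
    rw [β0, βq]
    linarith [dist_triangle m u (y n), dist_triangle (y 0) v (y n)]
  have near : ∀ {ℓ : ℤ → X} {c d : ℤ}, IsContractingLine B ℓ → c ≤ d → d ≤ c + 3 * M →
      dist (ℓ c) (ℓ d) ≤ 3 * M * B := by
    intro ℓ c d hℓ h1 h2
    simpa using hℓ.dist_le_mul_of_le (M := 3 * M) h1 (by push_cast; omega)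
  rcases lt_trichotomy k k' with hkk | hkk | hkk
  · -- The path would pass the middle of the corner at the end of the piece `k`, and again at the
    -- beginning of the piece `k'`, although there is a piece in between.
    have e1 := hβl.between (i := 0 - 3 * M) hb₀ hj (by omega) (by omega)
      (by linarith [hβs b₀ j (by omega)])
    have e2 := near hβl (c := 0 - 3 * M) (d := 0) (by omega) (by omega)
    have e3 := hαl.between (i := -p + 3 * M) hi₂ ha₁ (by omega) (by omega)
      (by linarith [hαs i' a₁ (by omega)])
    have e4 := near hαl (c := -p) (d := -p + 3 * M) (by omega) (by omega)
    rw [β0] at e2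
    rw [αp] at e4
    have f1 := dist_triangle (y 0) (β (0 - 3 * M)) m
    have f2 := dist_triangle_left m (y (k + 1)) (β (0 - 3 * M))
    have f3 := dist_triangle_right (y k') m (α (-p + 3 * M))
    have f4 := dist_triangle m (α (-p + 3 * M)) (y n)
    have p1 := align (i := 0) (j := k + 1) (k := n) (by omega) (by omega)
    have p2 := align (i := k + 1) (j := k') (k := n) (by omega) (by omega)
    have p3 := align (i := k + 1) (j := k + 2) (k := k') (by omega) (by omega)
    have p4 := h.long_alternating (k + 1) (le_blockExponent hp hq (k + 1))
    rw [← IsBrokenPath.dist_succ x₀ (alternating g₁ g₂), ← hy, ← hy] at p4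
    have f5 := dist_triangle (y 0) m (y n)
    have f6 := dist_triangle_left (y (k + 1)) (y k') m
    have f7 := dist_comm m (y (k + 1))
    have f8 := dist_comm (y k') m
    have f9 := dist_nonneg (x := y (k + 2)) (y := y k')
    linarith
  · omega
  · -- The path would pass the end of the corner before its beginning.
    have e1 := hαl.between (i := 0 - 3 * M) ha₀ hj₂ (by omega) (by omega)
      (by linarith [hαs a₀ j' (by omega)])
    have e2 := near hαl (c := 0 - 3 * M) (d := 0) (by omega) (by omega)
    have e3 := hβl.between (i := -q + 3 * M) hi hb₁ (by omega) (by omega)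
      (by linarith [hβs i b₁ (by omega)])
    have e4 := near hβl (c := -q) (d := -q + 3 * M) (by omega) (by omega)
    rw [α0] at e2
    rw [βq] at e4
    have f1 := dist_triangle (y 0) (α (0 - 3 * M)) u
    have f2 := dist_triangle_left u (y (k' + 1)) (α (0 - 3 * M))
    have f3 := dist_triangle_right (y k) v (β (-q + 3 * M))
    have f4 := dist_triangle v (β (-q + 3 * M)) (y n)
    have p1 := align (i := 0) (j := k' + 1) (k := n) (by omega) (by omega)
    have p2 := align (i := k' + 1) (j := k) (k := n) (by omega) (by omega)
    have f5 := dist_triangle4 u (y (k' + 1)) (y k) v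
    have f6 := dist_triangle (y 0) u (y n)
    have f7 := dist_triangle (y 0) v (y n)
    have f8 := dist_comm u v
    have f9 := dist_triangle v m u
    have f10 := dist_nonneg (x := v) (y := m)
    linarith

end IsTransversePair

end Detection

/-! ### A criterion for infinite-dimensionality -/

section Criterion

lemma map_pow_of_mem_realHomomorphisms {Γ : Type*} [Group Γ] {ψ : Γ → ℝ}
    (hψ : ψ ∈ realHomomorphisms Γ) (g : Γ) (k : ℕ) : ψ (g ^ k) = k * ψ g := by
  induction k with
  | zero =>
    have := hψ 1 1
    rw [mul_one] at this
    simp only [pow_zero, Nat.cast_zero, zero_mul]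
    linarith
  | succ k ih => rw [pow_succ, hψ, ih]; push_cast; ring

/-- Quasi-homomorphisms that detect more and more group elements. If on the elements of the sets
`S n`, which increase with `n`, homomorphisms vanish as soon as they vanish on `S 0`, and for each
`n` there is a quasi-homomorphism that is bounded on the powers of the elements of `S n`, but not
on those of all elements of the union, then `QH~(Γ)` is infinite-dimensional: the images in it of
the spaces of quasi-homomorphisms bounded on the powers of the elements of `S n` never become
stationary. -/
lemma not_finiteDimensional_QHTilde {Γ : Type*} [Group Γ] (S : ℕ → Set Γ) (hS : Monotone S)
    (hhom : ∀ ψ ∈ realHomomorphisms Γ, (∀ x ∈ S 0, ψ x = 0) → ∀ n, ∀ x ∈ S n, ψ x = 0)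
    (hqh : ∀ n, ∃ φ ∈ quasiHomomorphisms Γ, (∀ x ∈ S n, ∃ c, ∀ k : ℕ, |φ (x ^ k)| ≤ c) ∧
      ∃ m, ∃ x ∈ S m, ¬ ∃ c, ∀ k : ℕ, |φ (x ^ k)| ≤ c) :
    ¬ FiniteDimensional ℝ (QHTilde Γ) := by
  intro hfin
  let V : ℕ → Submodule ℝ (Γ → ℝ) := fun n =>
    { carrier := {φ | ∀ x ∈ S n, ∃ c, ∀ k : ℕ, |φ (x ^ k)| ≤ c}
      zero_mem' := fun x _ => ⟨0, fun k => by simp⟩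
      add_mem' := by
        intro φ ψ hφ hψ x hx
        obtain ⟨c, hc⟩ := hφ x hx
        obtain ⟨d, hd⟩ := hψ x hx
        exact ⟨c + d, fun k => (abs_add_le _ _).trans (add_le_add (hc k) (hd k))⟩
      smul_mem' := by
        intro r φ hφ x hx
        obtain ⟨c, hc⟩ := hφ x hx
        refine ⟨|r| * c, fun k => ?_⟩
        rw [Pi.smul_apply, smul_eq_mul, abs_mul]
        exact mul_le_mul_of_nonneg_left (hc k) (abs_nonneg r) }
  have hV : Antitone V := fun m n hmn φ hφ x hx => hφ x (hS hmn hx)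
  let W := (realHomomorphisms Γ ⊔ boundedFunctions Γ).submoduleOf (quasiHomomorphisms Γ)
  let f : ℕ →o (Submodule ℝ (QHTilde Γ))ᵒᵈ :=
    ⟨fun n => OrderDual.toDual (((V n).submoduleOf (quasiHomomorphisms Γ)).map W.mkQ),
      fun m n hmn => OrderDual.toDual_le_toDual.2
        (Submodule.map_mono (Submodule.comap_mono (hV hmn)))⟩
  obtain ⟨n, hn⟩ := IsArtinian.monotone_stabilizes f
  obtain ⟨φ, hφ, hφn, m, x, hx, hunb⟩ := hqh n
  have heq : ((V n).submoduleOf (quasiHomomorphisms Γ)).map W.mkQ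
      = ((V (max n m)).submoduleOf (quasiHomomorphisms Γ)).map W.mkQ := hn _ (le_max_left n m)
  have hmem : W.mkQ ⟨φ, hφ⟩ ∈ ((V (max n m)).submoduleOf (quasiHomomorphisms Γ)).map W.mkQ :=
    heq ▸ Submodule.mem_map_of_mem (show (⟨φ, hφ⟩ : quasiHomomorphisms Γ) ∈ _ from hφn)
  obtain ⟨ψ, hψ, hψφ⟩ := Submodule.mem_map.1 hmem
  have hW : ψ - ⟨φ, hφ⟩ ∈ W := (Submodule.Quotient.eq W).1 hψφ
  obtain ⟨η, hη, b, ⟨d, hd⟩, hηb⟩ := Submodule.mem_sup.1 (Submodule.mem_comap.1 hW)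
  have hval : ∀ g, η g = (ψ : Γ → ℝ) g - φ g - b g := fun g => by
    have := congrFun hηb g
    simp only [Pi.add_apply, Submodule.subtype_apply, AddSubgroupClass.coe_sub, Pi.sub_apply]
      at this
    linarith
  have hpow := map_pow_of_mem_realHomomorphisms hη
  have hzero : ∀ g ∈ S 0, η g = 0 := by
    intro g hg
    obtain ⟨c, hc⟩ := hφn g (hS n.zero_le hg)
    obtain ⟨c', hc'⟩ : ∃ c', ∀ k : ℕ, |(ψ : Γ → ℝ) (g ^ k)| ≤ c' :=
      hψ g (hS (Nat.zero_le _) hg)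
    by_contra hne
    obtain ⟨k, hk⟩ := exists_nat_gt ((c + c' + d) / |η g|)
    rw [div_lt_iff₀ (abs_pos.2 hne)] at hk
    have h1 : |η (g ^ k)| = k * |η g| := by rw [hpow, abs_mul, Nat.abs_cast]
    rw [hval] at h1
    have h2 := abs_sub ((ψ : Γ → ℝ) (g ^ k) - φ (g ^ k)) (b (g ^ k))
    have h3 := abs_sub ((ψ : Γ → ℝ) (g ^ k)) (φ (g ^ k))
    linarith [hc k, hc' k, hd (g ^ k)]
  obtain ⟨c, hc⟩ := hψ x (hS (le_max_right n m) hx)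
  refine hunb ⟨c + d, fun k => ?_⟩
  have h1 := hval (x ^ k)
  rw [hpow, hhom η hη hzero m x hx, mul_zero] at h1
  have h2 : φ (x ^ k) = (ψ : Γ → ℝ) (x ^ k) - b (x ^ k) := by linarith
  rw [h2]
  exact (abs_sub _ _).trans (add_le_add (hc k) (hd _))

end Criterion

/-! ### Growth along powers of blocks -/

section Growth

variable {Γ X : Type*} [Group Γ] [MulAction Γ X] [MetricSpace X] [IsIsometricSMul Γ X]

namespace IsTransversePair

variable {B : ℝ} {N : ℤ} {M s : ℕ} {x₀ : X} {g₁ g₂ : Γ}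

/-- Every period of the path with exponents `p, q, s, s, …` contains the corner `g₁ ^ p * g₂ ^ q`,
and the discount for it exceeds the loss of length at the break points. -/
lemma discountedDist_pow_le (h : IsTransversePair B N M s x₀ g₁ g₂) {p q : ℕ} (hp : s ≤ p)
    (hq : s ≤ q) (n : ℕ) :
    discountedDist (cornerSegment x₀ g₁ g₂ p q) (38 * B + 1) x₀ (block g₁ g₂ p q s ^ n • x₀)
      ≤ dist x₀ (block g₁ g₂ p q s ^ n • x₀) - n := by
  have hB := h.nonneg
  have hP := h.isBrokenPath hp hq
  have hD := h.isDiscountSystem (q := q) hp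
  obtain ⟨w, hw⟩ : ∃ w, w = g₁ ^ p * g₂ ^ q := ⟨_, rfl⟩
  obtain ⟨z, hz⟩ : ∃ z, z = g₁ ^ s * g₂ ^ s := ⟨_, rfl⟩
  have hF : block g₁ g₂ p q s = w * z := by rw [hw, hz]; rfl
  have p2 : partialProd (alternating g₁ g₂) (blockExponent p q s) 2 = w := by
    simp [partialProd, alternating, blockExponent, hw]
  have p4 := partialProd_four_mul g₁ g₂ p q s 1
  rw [mul_one, pow_one, hF] at p4
  have hlen : dist x₀ (w • x₀) + dist x₀ (z • x₀) ≤ dist x₀ ((w * z) • x₀) + 19 * B := by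
    have := hP.dist_add_dist_le (i := 0) (j := 2) (k := 4) (by omega) (by omega)
    rw [p2, p4] at this
    simpa only [partialProd, one_smul, mul_smul, dist_smul] using this
  have hcost : discountedDist (cornerSegment x₀ g₁ g₂ p q) (38 * B + 1) x₀ ((w * z) • x₀)
      ≤ dist x₀ (w • x₀) - (38 * B + 1) + dist x₀ (z • x₀) := by
    have h1 := hD.discountedDist_source_target_le 1
    have h2 := hD.discountedDist_le_add_dist x₀ (w • x₀) ((w * z) • x₀)
    simp only [cornerSegment, one_smul, one_mul, smul_smul, ← hw] at h1
    rw [mul_smul, dist_smul] at h2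
    rw [mul_smul]
    linarith
  induction n with
  | zero => simpa using hD.discountedDist_le_dist x₀ x₀
  | succ n ih =>
    rw [hF] at ih ⊢
    have h1 := hP.dist_add_dist_le (i := 0) (j := 4 * n) (k := 4 * (n + 1)) (by omega) (by omega)
    rw [partialProd_four_mul, partialProd_four_mul, hF, pow_succ] at h1
    simp only [partialProd, one_smul] at h1
    rw [mul_smul ((w * z) ^ n), dist_smul] at h1
    have h2 := hD.discountedDist_triangle x₀ ((w * z) ^ n • x₀) ((w * z) ^ n • (w * z) • x₀)
    rw [discountedDist_smul] at h2
    rw [pow_succ, mul_smul ((w * z) ^ n)]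
    push_cast
    linarith

/-- Elements with small exponents are detected only by short corners, so that the sets of blocks
with bounded side lengths satisfy the hypotheses of `not_finiteDimensional_QHTilde`. -/
lemma not_finiteDimensional (h : IsTransversePair B N M s x₀ g₁ g₂)
    (hX : IsGeodesicMetricSpace X) : ¬ FiniteDimensional ℝ (QHTilde Γ) := by
  have hB := h.nonneg
  have hMB : 0 ≤ (M : ℝ) * B := mul_nonneg M.cast_nonneg hB
  obtain ⟨R, hR⟩ : ∃ R, R = dist x₀ (g₁ ^ s • x₀) + dist x₀ (g₁ ^ (s + 1) • x₀)
    + dist x₀ (g₂ ^ s • x₀) + dist x₀ (g₂ ^ (s + 1) • x₀) := ⟨_, rfl⟩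
  have r1 := dist_nonneg (x := x₀) (y := g₁ ^ s • x₀)
  have r2 := dist_nonneg (x := x₀) (y := g₁ ^ (s + 1) • x₀)
  have r3 := dist_nonneg (x := x₀) (y := g₂ ^ s • x₀)
  have r4 := dist_nonneg (x := x₀) (y := g₂ ^ (s + 1) • x₀)
  let S : ℕ → Set Γ := fun n => {x | ∃ a b, s ≤ a ∧ s ≤ b ∧ dist x₀ (g₁ ^ a • x₀) ≤ R + n ∧
    dist x₀ (g₂ ^ b • x₀) ≤ R + n ∧ x = block g₁ g₂ a b s}
  refine not_finiteDimensional_QHTilde S ?_ ?_ ?_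
  · rintro m n hmn x ⟨a, b, ha, hb, ha', hb', rfl⟩
    have : (m : ℝ) ≤ n := by exact_mod_cast hmn
    exact ⟨a, b, ha, hb, by linarith, by linarith, rfl⟩
  · -- A homomorphism vanishing on three suitable blocks vanishes at `g₁` and `g₂`.
    intro ψ hψ h0 n x hx
    have hpow := map_pow_of_mem_realHomomorphisms hψ
    have hval : ∀ a b, ψ (block g₁ g₂ a b s) = a * ψ g₁ + b * ψ g₂ + (s * ψ g₁ + s * ψ g₂) := by
      intro a b
      rw [block, hψ, hψ, hψ, hpow, hpow, hpow, hpow]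
    have e1 := h0 _ ⟨s, s, le_rfl, le_rfl, by push_cast; linarith, by push_cast; linarith, rfl⟩
    have e2 := h0 _ ⟨s + 1, s, by omega, le_rfl, by push_cast; linarith, by push_cast; linarith,
      rfl⟩
    have e3 := h0 _ ⟨s, s + 1, le_rfl, by omega, by push_cast; linarith, by push_cast; linarith,
      rfl⟩
    rw [hval] at e1 e2 e3
    push_cast at e2 e3
    obtain ⟨a, b, -, -, -, -, rfl⟩ := hx
    rw [hval, show ψ g₁ = 0 by linarith, show ψ g₂ = 0 by linarith]
    ring
  · intro n
    obtain ⟨p₀, hp₀⟩ := h.isAxis₁.exists_forall_le_dist_pow (R + n + (6 * M + 3) * B + 1)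
    obtain ⟨p, hp⟩ : ∃ p, p = max s p₀ := ⟨_, rfl⟩
    obtain ⟨q₀, hq₀⟩ := h.isAxis₂.exists_forall_le_dist_pow
      (dist x₀ (g₁ ^ p • x₀) + (6 * M + 3) * B + 1)
    obtain ⟨q, hq⟩ : ∃ q, q = max s q₀ := ⟨_, rfl⟩
    have hsp : s ≤ p := hp ▸ le_max_left _ _
    have hsq : s ≤ q := hq ▸ le_max_left _ _
    have hlp := hp₀ p (hp ▸ le_max_right _ _)
    have hlq := hq₀ q (hq ▸ le_max_right _ _)
    have hn : (0 : ℝ) ≤ n := n.cast_nonneg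
    refine ⟨cornerCount x₀ g₁ g₂ p q (38 * B + 1), h.cornerCount_mem hX hsp, ?_, ?_⟩
    · rintro _ ⟨a, b, ha, hb, ha', hb', rfl⟩
      refine ⟨1, fun k => ?_⟩
      rw [← partialProd_four_mul]
      refine h.abs_cornerCount_le ha hb hsp (fun k => ?_) _
      have : dist x₀ (alternating g₁ g₂ k ^ blockExponent a b s k • x₀) ≤ R + n := by
        unfold alternating blockExponent
        split_ifs with h1 h2 h3 h4 h5
        · exact ha'
        · rw [Nat.even_iff] at h1; omega
        · linarith
        · rw [Nat.even_iff] at h1; omega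
        · exact hb'
        · linarith
      linarith
    · obtain ⟨m, hm⟩ := exists_nat_ge (dist x₀ (g₁ ^ p • x₀) + dist x₀ (g₂ ^ q • x₀))
      have d1 := dist_nonneg (x := x₀) (y := g₁ ^ p • x₀)
      have d2 := dist_nonneg (x := x₀) (y := g₂ ^ q • x₀)
      refine ⟨m, _, ⟨p, q, hsp, hsq, by linarith, by linarith, rfl⟩, ?_⟩
      rintro ⟨c, hc⟩
      obtain ⟨k, hk⟩ := exists_nat_gt (c + 1)
      have h1 := h.discountedDist_pow_le hsp hsq k
      have h2 := h.dist_sub_one_le_discountedDist hsp hsq (by linarith) (by linarith)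
        (by linarith) (4 * k)
      rw [partialProd_four_mul] at h2
      have h3 := (abs_le.1 (hc k)).1
      rw [cornerCount] at h3
      linarith [dist_comm x₀ (block g₁ g₂ p q s ^ k • x₀)]

end IsTransversePair

end Growth

theorem theoremt1 {Γ : Type*} [Group Γ] {X : Type*} [MetricSpace X]
    [MulAction Γ X] [IsIsometricSMul Γ X]
    (hX : IsGeodesicMetricSpace X) (C : ℝ) (hC : 0 < C) (hDD : AxiomDD X C) (hFT : AxiomFT X C)
    (x₀ : X) (g₁ g₂ : Γ) (h₁ : IsRankOne x₀ g₁) (h₂ : IsRankOne x₀ g₂)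
    (hind : AreIndependent x₀ g₁ g₂) (hne : ¬ AreEquivalent x₀ g₁ g₂) :
    ¬ FiniteDimensional ℝ (QHTilde Γ) := by
  classical
  obtain ⟨B₁, hB₁⟩ := h₁.exists_isContractingLine hX hC hDD hFT
  obtain ⟨B₂, hB₂⟩ := h₂.exists_isContractingLine hX hC hDD hFT
  have a₁ : IsAxis B₁ x₀ g₁ := ⟨hB₁, h₁.exists_isSparse⟩
  have a₂ : IsAxis B₂ x₀ g₂ := ⟨hB₂, h₂.exists_isSparse⟩
  have b₁ := a₁.mono (le_max_left B₁ B₂)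
  have b₂ := a₂.mono (le_max_right B₁ B₂)
  obtain ⟨c, hc⟩ := hind.exists_dist_add_dist_le b₁ b₂
  obtain ⟨B, hB⟩ : ∃ B, B = max (max B₁ B₂) c := ⟨_, rfl⟩
  have hcB : c ≤ B := hB ▸ le_max_right _ _
  have c₁ : IsAxis B x₀ g₁ := b₁.mono (hB ▸ le_max_left _ _)
  have c₂ : IsAxis B x₀ g₂ := b₂.mono (hB ▸ le_max_left _ _)
  obtain ⟨N₁, hN₁, hs₁⟩ := c₁.sparse (200 * B + 20)
  obtain ⟨N₂, hN₂, hs₂⟩ := c₂.sparse (200 * B + 20)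
  obtain ⟨M₀, hM₀⟩ := exists_overlapBound (B := B) (x₀ := x₀) (3 * B)
    (({g₁, g₂} : Finset Γ) ×ˢ ({g₁, g₁⁻¹, g₂⁻¹} : Finset Γ)) (by
      rintro ⟨g, τ⟩ hp
      simp only [Finset.mem_product, Finset.mem_insert, Finset.mem_singleton] at hp
      refine ⟨?_, ?_⟩
      · rcases hp.1 with rfl | rfl
        exacts [c₁, c₂]
      · rcases hp.2 with rfl | rfl | rfl
        exacts [c₁, c₁.inv, c₂.inv])
  obtain ⟨N, hN⟩ : ∃ N, N = max N₁ N₂ := ⟨_, rfl⟩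
  have hNN₁ : N₁ ≤ N := hN ▸ le_max_left _ _
  have hNN₂ : N₂ ≤ N := hN ▸ le_max_right _ _
  obtain ⟨M, hM⟩ : ∃ M, M = max M₀ N.toNat := ⟨_, rfl⟩
  have hMM : M₀ ≤ M := hM ▸ le_max_left _ _
  have hNM : N.toNat ≤ M := hM ▸ le_max_right _ _
  obtain ⟨s₁, l₁⟩ := c₁.exists_forall_le_dist_pow ((6 * M + 200) * B + 10)
  obtain ⟨s₂, l₂⟩ := c₂.exists_forall_le_dist_pow ((6 * M + 200) * B + 10)
  have hpair : IsTransversePair B N M (s₁ + s₂ + 7 * M) x₀ g₁ g₂ :=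
    { isAxis₁ := c₁
      isAxis₂ := c₂
      pos := by omega
      sparse₁ := hs₁ N hNN₁
      sparse₂ := hs₂ N hNN₂
      corner := fun m n => (hc m n).trans (by linarith)
      not_overlap := fun ho => hne (ho.areEquivalent hX hC hFT)
      bound := fun g hg τ hτ ho => (hM₀ (g, τ) (by
        simpa only [Finset.mem_product, Finset.mem_insert, Finset.mem_singleton,
          Set.mem_insert_iff, Set.mem_singleton_iff] using
          And.intro hg hτ) ho).mono hMM
      le_bound := by omega
      le_exponent := by push_cast; omega
      mul_bound_le := by omega
      long₁ := fun m hm => l₁ m (by omega)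
      long₂ := fun m hm => l₂ m (by omega) }
  exact hpair.not_finiteDimensional hX
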